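/- Let $\mathbb R\langle x\rangle$ be the free associative unital $\mathbb R$-algebra on $g$ noncommuting variables $x=(x_1,\dots,x_g)$, with the involution ${}^*$ that is $\mathbb R$-linear, fixes each $x_i$ and reverses words. Let $\mathbb R\langle x\rangle_k$ be the space of polynomials of degree at most $k$, and let $\sigma_\#(k)=\dim\mathbb R\langle x\rangle_k=\sum_{j=0}^k g^j$. Let $a\ge 0$ be an integer, let $S\subset\mathbb R\langle x\rangle_a$ be a finite set of symmetric polynomials ($s^*=s$), and put $Q=\{1-s^*s : s\in S\}$. For integers $\alpha,\beta\ge 0$ let $$M_{\alpha,\beta}(Q)=\Big\{\sum_{i}^{\text{finite}} h_i^*h_i+\sum_{q\in Q}\sum_j^{\text{finite}} f_{j,q}^*\,q\,f_{j,q} \;:\; h_i\in\mathbb R\langle x\rangle_\alpha,\ f_{j,q}\in\mathbb R\langle x\rangle_\beta\Big\}.$$ Assume that the positivity set $\mathfrak P_Q$ contains a noncommutative neighborhood of $0$: there is $\varepsilon>0$ such that for every $n$ and every $g$-tuple $X=(X_1,\dots,X_g)$ of real symmetric $n\times n$ matrices with $\big(\sum_i\|X_i\|^2\big)^{1/2}<\varepsilon$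 (operator norms), one has $q(X)\succeq 0$ for all $q\in Q$. For a tuple $X=(X_1,\dots,X_g)$ of symmetric operators on a finite-dimensional real Hilbert space $\mathcal X$ and $\zeta\in\mathcal X$, let $P^{\beta}_{X,\zeta}$ be the orthogonal projection of $\mathcal X$ onto the subspace $\{f(X)\zeta : f\in\mathbb R\langle x\rangle_\beta\}$. **Theorem.** Let $d,\beta$ be integers with $0\le\beta<d$, and let $p\in\mathbb R\langle x\rangle_{2d}$ be symmetric. Then $p\in M_{d+a,\beta}(Q)$ if and only if the following holds: for every real Hilbert space $\mathcal X$ of dimension $\sigma_\#(d+a-1)$, every $g$-tuple $X$ of symmetric operators on $\mathcal X$ and every $\zeta\in\mathcal X$, $$P^{\beta}_{X,\zeta}\big(1-s^*(X)s(X)\big)P^{\beta}_{X,\zeta}\succeq 0\ \text{ for all } s\in S\quad\text{implies}\quad \langle p(X)\zeta,\zeta\rangle\ge 0.$$ -/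

import Mathlib

noncomputable section

namespace FreePos

/-- Noncommutative polynomials over `ℝ` in the variables `x_0, …, x_{g-1}`. The involution `star`
that Mathlib puts on this algebra fixes the scalars and the variables and reverses words. -/
abbrev NCPoly (g : ℕ) : Type := FreeAlgebra ℝ (Fin g)

/-- The word with the given list of letters. The empty list gives `1`. -/
def word {g : ℕ} (l : List (Fin g)) : NCPoly g :=
  (l.map (FreeAlgebra.ι ℝ)).prod

/-- The space of polynomials of degree at most `k`: the span of the words of length at most `k`. -/
def degLE (g k : ℕ) : Submodule ℝ (NCPoly g) :=
  Submodule.span ℝ {w | ∃ l : List (Fin g), l.length ≤ k ∧ w = word l}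

/-- The dimension of the space of polynomials of degree at most `k` in `g` variables. -/
def sigmaDim (g k : ℕ) : ℕ :=
  Module.finrank ℝ (degLE g k)

/-- The set `{1 - s* s : s ∈ S}`. -/
def complSquares {g : ℕ} (S : Finset (NCPoly g)) : Set (NCPoly g) :=
  {q | ∃ s ∈ S, q = 1 - star s * s}

/-- The finite sums of hermitian squares `f* f` with `deg f ≤ α`. -/
def sos (g α : ℕ) : AddSubmonoid (NCPoly g) :=
  AddSubmonoid.closure {h | ∃ f ∈ degLE g α, h = star f * f}

/-- The finite sums of terms `f* q f` with `q ∈ Q` and `deg f ≤ β`. -/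
def weightedSos {g : ℕ} (β : ℕ) (Q : Set (NCPoly g)) : AddSubmonoid (NCPoly g) :=
  AddSubmonoid.closure {h | ∃ q ∈ Q, ∃ f ∈ degLE g β, h = star f * q * f}

/-- The truncated quadratic module: sums of an element of `sos g α` and one of
`weightedSos β Q`. -/
def quadModule {g : ℕ} (α β : ℕ) (Q : Set (NCPoly g)) : Set (NCPoly g) :=
  {p | ∃ h ∈ sos g α, ∃ k ∈ weightedSos β Q, p = h + k}

section Evaluation

variable {g : ℕ} {E : Type*} [NormedAddCommGroup E] [InnerProductSpace ℝ E]

/-- Evaluation of polynomials at a tuple of operators. -/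
def evalAt (X : Fin g → (E →L[ℝ] E)) : NCPoly g →ₐ[ℝ] (E →L[ℝ] E) :=
  FreeAlgebra.lift ℝ X

/-- A tuple of symmetric operators. -/
def IsSymmTuple (X : Fin g → (E →L[ℝ] E)) : Prop :=
  ∀ i, (X i : E →ₗ[ℝ] E).IsSymmetric

/-- The subspace of all `f(X) ζ` with `deg f ≤ η`. -/
def orbitSpace (X : Fin g → (E →L[ℝ] E)) (ζ : E) (η : ℕ) : Submodule ℝ E :=
  (degLE g η).map
    ((ContinuousLinearMap.apply ℝ E ζ : (E →L[ℝ] E) →ₗ[ℝ] E) ∘ₗ (evalAt X).toLinearMap)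

/-- The orthogonal projection of `E` onto the subspace of all `f(X) ζ` with `deg f ≤ η`. -/
def orbitProj [FiniteDimensional ℝ E] (X : Fin g → (E →L[ℝ] E)) (ζ : E) (η : ℕ) : E →L[ℝ] E :=
  (orbitSpace X ζ η).starProjection

/-- The part of the noncommutative semialgebraic set of `Q` that consists of tuples of operators
on `E`. -/
def posSet (Q : Set (NCPoly g)) (E : Type*) [NormedAddCommGroup E] [InnerProductSpace ℝ E] :
    Set (Fin g → (E →L[ℝ] E)) :=
  {X | IsSymmTuple X ∧ ∀ q ∈ Q, (evalAt X q).IsPositive}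

end Evaluation

/-- The noncommutative semialgebraic set of `Q` contains a noncommutative neighborhood of `0`.
Symmetric `n × n` matrices are written as symmetric operators on Euclidean `n`-space, and
`‖X i‖` is the operator norm. -/
def ContainsNCNhd {g : ℕ} (Q : Set (NCPoly g)) : Prop :=
  ∃ ε : ℝ, 0 < ε ∧ ∀ (n : ℕ)
    (X : Fin g → (EuclideanSpace ℝ (Fin n) →L[ℝ] EuclideanSpace ℝ (Fin n))),
    IsSymmTuple X → Real.sqrt (∑ i, ‖X i‖ ^ 2) < ε →
      X ∈ posSet Q (EuclideanSpace ℝ (Fin n))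

end FreePos

end

noncomputable section

namespace FreePos

section Polynomials

variable {g : ℕ}

@[simp] lemma word_nil : word ([] : List (Fin g)) = 1 := rfl

lemma word_cons (i : Fin g) (l : List (Fin g)) :
    word (i :: l) = FreeAlgebra.ι ℝ i * word l := by
  simp [word]

lemma word_append (l l' : List (Fin g)) : word (l ++ l') = word l * word l' := by
  simp [word]

lemma star_word (l : List (Fin g)) : star (word l) = word l.reverse := by
  induction l with
  | nil => simp
  | cons i l ih => simp [word_cons, word_append, ih]

lemma word_mem_degLE {l : List (Fin g)} {k : ℕ} (h : l.length ≤ k) : word l ∈ degLE g k :=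
  Submodule.subset_span ⟨l, h, rfl⟩

lemma one_mem_degLE (k : ℕ) : (1 : NCPoly g) ∈ degLE g k := by
  simpa using word_mem_degLE (l := ([] : List (Fin g))) (k := k) (by simp)

lemma degLE_mono {j k : ℕ} (h : j ≤ k) : degLE g j ≤ degLE g k :=
  Submodule.span_mono fun _ ⟨l, hl, hw⟩ => ⟨l, hl.trans h, hw⟩

lemma mul_mem_degLE {j k : ℕ} {f h : NCPoly g} (hf : f ∈ degLE g j) (hh : h ∈ degLE g k) :
    f * h ∈ degLE g (j + k) := by
  have key : degLE g j * degLE g k ≤ degLE g (j + k) := by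
    rw [degLE, degLE, Submodule.span_mul_span, degLE]
    refine Submodule.span_mono ?_
    rintro _ ⟨_, ⟨l, hl, rfl⟩, _, ⟨l', hl', rfl⟩, rfl⟩
    exact ⟨l ++ l', by simp; omega, (word_append l l').symm⟩
  exact key (Submodule.mul_mem_mul hf hh)

/-- The involution of `NCPoly g` as a linear map. -/
def starLinear (g : ℕ) : NCPoly g →ₗ[ℝ] NCPoly g where
  toFun := star
  map_add' := star_add
  map_smul' r f := by
    rw [Algebra.smul_def, star_mul, FreeAlgebra.star_algebraMap, RingHom.id_apply, Algebra.smul_def,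
      Algebra.commutes]

@[simp] lemma starLinear_apply (f : NCPoly g) : starLinear g f = star f := rfl

lemma star_smul_poly (r : ℝ) (f : NCPoly g) : star (r • f) = r • star f :=
  (starLinear g).map_smul r f

lemma star_mem_degLE {k : ℕ} {f : NCPoly g} (hf : f ∈ degLE g k) : star f ∈ degLE g k := by
  have : degLE g k ≤ (degLE g k).comap (starLinear g) := by
    refine Submodule.span_le.2 ?_
    rintro _ ⟨l, hl, rfl⟩
    simpa [star_word] using word_mem_degLE (by simpa using hl)
  exact this hf

instance finite_words (g k : ℕ) : Finite {l : List (Fin g) // l.length ≤ k} :=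
  (List.finite_length_le (Fin g) k).to_subtype

lemma degLE_eq_span_range (g k : ℕ) :
    degLE g k = Submodule.span ℝ
      (Set.range fun l : {l : List (Fin g) // l.length ≤ k} => word l.1) := by
  rw [degLE]
  congr 1
  ext w
  simp [eq_comm]

instance finiteDimensional_degLE (g k : ℕ) : FiniteDimensional ℝ (degLE g k) := by
  rw [degLE_eq_span_range]
  exact FiniteDimensional.span_of_finite ℝ (Set.finite_range _)

lemma linearIndependent_word : LinearIndependent ℝ (word (g := g)) := by
  have h : (word (g := g)) = FreeAlgebra.basisFreeMonoid ℝ (Fin g) ∘ FreeMonoid.ofList := by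
    funext l
    apply FreeAlgebra.equivMonoidAlgebraFreeMonoid.injective
    have h2 : FreeAlgebra.equivMonoidAlgebraFreeMonoid
        ((FreeAlgebra.basisFreeMonoid ℝ (Fin g) ∘ FreeMonoid.ofList) l) =
        MonoidAlgebra.of ℝ _ (FreeMonoid.ofList l) := by
      simp [FreeAlgebra.basisFreeMonoid]
    rw [h2]
    clear h2
    induction l with
    | nil => simp [MonoidAlgebra.one_def]
    | cons i l ih =>
      rw [word_cons, map_mul, ih, FreeMonoid.ofList_cons, map_mul]
      simp [FreeAlgebra.equivMonoidAlgebraFreeMonoid]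
  rw [h]
  exact (FreeAlgebra.basisFreeMonoid ℝ (Fin g)).linearIndependent.comp _ FreeMonoid.ofList.injective

lemma sigmaDim_eq_card (g k : ℕ) : sigmaDim g k = Nat.card {l : List (Fin g) // l.length ≤ k} := by
  have := Fintype.ofFinite {l : List (Fin g) // l.length ≤ k}
  rw [sigmaDim, degLE_eq_span_range, finrank_span_eq_card, Nat.card_eq_fintype_card]
  exact linearIndependent_word.comp _ Subtype.val_injective

lemma exists_word_eq_star_mul {l : List (Fin g)} {j k : ℕ} (h : l.length ≤ j + k) :
    ∃ u v : List (Fin g), u.length ≤ j ∧ v.length ≤ k ∧ word l = star (word u) * word v := by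
  refine ⟨(l.take j).reverse, l.drop j, by simp, by simp; omega, ?_⟩
  rw [star_word, List.reverse_reverse, ← word_append, List.take_append_drop]

lemma mem_degLE_zero {f : NCPoly g} : f ∈ degLE g 0 ↔ ∃ c : ℝ, f = c • 1 := by
  have h : {w : NCPoly g | ∃ l : List (Fin g), l.length ≤ 0 ∧ w = word l} = {1} := by
    ext w
    simp
  rw [degLE, h, Submodule.mem_span_singleton]
  simp [eq_comm]

/-- A polynomial of degree at most `n + 1` is a homogeneous part plus lower terms. -/
lemma exists_eq_sum_add_of_mem_degLE_succ {n : ℕ} {f : NCPoly g} (hf : f ∈ degLE g (n + 1)) :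
    ∃ (c : List.Vector (Fin g) (n + 1) → ℝ), ∃ r ∈ degLE g n,
      f = ∑ w, c w • word w.toList + r := by
  refine Submodule.span_induction ?_ ?_ ?_ ?_ hf
  · rintro _ ⟨l, hl, rfl⟩
    rcases Nat.lt_or_ge l.length (n + 1) with h | h
    · exact ⟨0, word l, word_mem_degLE (by omega), by simp⟩
    · obtain ⟨w, hw⟩ : ∃ w : List.Vector (Fin g) (n + 1), w.toList = l := ⟨⟨l, by omega⟩, rfl⟩
      refine ⟨Pi.single w 1, 0, zero_mem _, ?_⟩
      rw [Finset.sum_eq_single w]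
      · simp [hw]
      · intro b _ hb
        simp [hb]
      · simp
  · exact ⟨0, 0, zero_mem _, by simp⟩
  · rintro _ _ _ _ ⟨c, r, hr, rfl⟩ ⟨c', r', hr', rfl⟩
    refine ⟨c + c', r + r', add_mem hr hr', ?_⟩
    simp only [Pi.add_apply, add_smul, Finset.sum_add_distrib]
    abel
  · rintro t _ _ ⟨c, r, hr, rfl⟩
    exact ⟨t • c, t • r, Submodule.smul_mem _ _ hr, by simp [Finset.smul_sum, mul_smul]⟩

/-- The top-degree part of a polynomial of degree at most `2 * n + 2` as a Gram matrix. -/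
lemma exists_gram_of_mem_degLE {n : ℕ} {f : NCPoly g} (hf : f ∈ degLE g (2 * (n + 1))) :
    ∃ (G : Matrix (List.Vector (Fin g) (n + 1)) (List.Vector (Fin g) (n + 1)) ℝ),
      ∃ r ∈ degLE g (2 * n + 1),
        f = ∑ u, ∑ v, G u v • (star (word u.toList) * word v.toList) + r := by
  refine Submodule.span_induction ?_ ?_ ?_ ?_ hf
  · rintro _ ⟨l, hl, rfl⟩
    rcases Nat.lt_or_ge l.length (2 * (n + 1)) with h | h
    · exact ⟨0, word l, word_mem_degLE (by omega), by simp⟩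
    · obtain ⟨u, hu⟩ : ∃ u : List.Vector (Fin g) (n + 1), u.toList = (l.take (n + 1)).reverse :=
        ⟨⟨(l.take (n + 1)).reverse, by simp; omega⟩, rfl⟩
      obtain ⟨v, hv⟩ : ∃ v : List.Vector (Fin g) (n + 1), v.toList = l.drop (n + 1) :=
        ⟨⟨l.drop (n + 1), by simp; omega⟩, rfl⟩
      refine ⟨Matrix.single u v 1, 0, zero_mem _, ?_⟩
      rw [Finset.sum_eq_single u, Finset.sum_eq_single v]
      · simp [hu, hv, star_word, ← word_append]
      · intro b _ hb
        simp [Matrix.single_apply_of_col_ne _ _ hb.symm]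
      · simp
      · intro b _ hb
        simp [Matrix.single_apply_of_row_ne hb.symm]
      · simp
  · exact ⟨0, 0, zero_mem _, by simp⟩
  · rintro _ _ _ _ ⟨c, r, hr, rfl⟩ ⟨c', r', hr', rfl⟩
    refine ⟨c + c', r + r', add_mem hr hr', ?_⟩
    simp only [Matrix.add_apply, add_smul, Finset.sum_add_distrib]
    abel
  · rintro t _ _ ⟨c, r, hr, rfl⟩
    exact ⟨t • c, t • r, Submodule.smul_mem _ _ hr, by simp [Finset.smul_sum, mul_smul]⟩

/-- For a symmetric polynomial the Gram matrix of the top-degree part can be taken symmetric. -/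
lemma exists_isSymm_gram_of_mem_degLE {n : ℕ} {f : NCPoly g} (hf : f ∈ degLE g (2 * (n + 1)))
    (hstar : star f = f) :
    ∃ (G : Matrix (List.Vector (Fin g) (n + 1)) (List.Vector (Fin g) (n + 1)) ℝ),
      G.IsSymm ∧ ∃ r ∈ degLE g (2 * n + 1),
        f = ∑ u, ∑ v, G u v • (star (word u.toList) * word v.toList) + r := by
  obtain ⟨G, r, hr, hG⟩ := exists_gram_of_mem_degLE hf
  refine ⟨(2⁻¹ : ℝ) • (G + G.transpose), ?_, (2⁻¹ : ℝ) • (r + star r),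
    Submodule.smul_mem _ _ (add_mem hr (star_mem_degLE hr)), ?_⟩
  · simp [Matrix.IsSymm, add_comm]
  · have h2 : star f = ∑ u, ∑ v, G.transpose u v • (star (word u.toList) * word v.toList) +
        star r := by
      rw [hG, star_add, star_sum, Finset.sum_comm]
      simp only [star_sum, star_smul_poly, star_mul, star_star, Matrix.transpose_apply]
    have h3 : f = (2⁻¹ : ℝ) • (f + star f) := by
      rw [hstar, ← two_smul ℝ f, smul_smul]; norm_num
    rw [h3, h2]
    nth_rw 1 [hG]
    simp only [Matrix.smul_apply, Matrix.add_apply, smul_add, add_smul, Finset.sum_add_distrib,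
      Finset.smul_sum, smul_smul, smul_eq_mul, mul_add]
    abel

end Polynomials

section Evaluation

variable {g : ℕ} {E F : Type*} [NormedAddCommGroup E] [InnerProductSpace ℝ E]
  [NormedAddCommGroup F] [InnerProductSpace ℝ F]

@[simp] lemma evalAt_ι (X : Fin g → (E →L[ℝ] E)) (i : Fin g) :
    evalAt X (FreeAlgebra.ι ℝ i) = X i := by
  simp [evalAt]

lemma evalAt_word_cons_apply (X : Fin g → (E →L[ℝ] E)) (i : Fin g) (l : List (Fin g)) (x : E) :
    evalAt X (word (i :: l)) x = X i (evalAt X (word l) x) := by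
  simp [word_cons]

lemma inner_evalAt_left {X : Fin g → (E →L[ℝ] E)} (hX : IsSymmTuple X) (f : NCPoly g) (x y : E) :
    inner ℝ (evalAt X f x) y = inner ℝ x (evalAt X (star f) y) := by
  induction f using FreeAlgebra.induction generalizing x y with
  | grade0 r => simp [Algebra.algebraMap_eq_smul_one, inner_smul_left, inner_smul_right,
      star_smul_poly]
  | grade1 i => simpa using hX i x y
  | mul a b ha hb => simp [ha, hb]
  | add a b ha hb => simp [ha, hb, inner_add_left, inner_add_right]

lemma inner_evalAt_star_mul {X : Fin g → (E →L[ℝ] E)} (hX : IsSymmTuple X) (f h : NCPoly g)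
    (x : E) : inner ℝ (evalAt X (star f * h) x) x = inner ℝ (evalAt X h x) (evalAt X f x) := by
  rw [map_mul, mul_apply_eq_comp, inner_evalAt_left hX, star_star]

lemma mem_orbitSpace {X : Fin g → (E →L[ℝ] E)} {ζ : E} {η : ℕ} {y : E} :
    y ∈ orbitSpace X ζ η ↔ ∃ f ∈ degLE g η, evalAt X f ζ = y := by
  simp [orbitSpace]

lemma inner_evalAt_one_sub_star_mul {X : Fin g → (E →L[ℝ] E)} (hX : IsSymmTuple X)
    (s : NCPoly g) (y : E) :
    inner ℝ (evalAt X (1 - star s * s) y) y = ‖y‖ ^ 2 - ‖evalAt X s y‖ ^ 2 := by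
  rw [map_sub, map_one, sub_apply, inner_sub_left, inner_evalAt_star_mul hX]
  simp

lemma norm_evalAt_le_of_isPositive {X : Fin g → (E →L[ℝ] E)} (hX : IsSymmTuple X)
    {s : NCPoly g} (h : (evalAt X (1 - star s * s)).IsPositive) (y : E) :
    ‖evalAt X s y‖ ≤ ‖y‖ := by
  have h1 := h.inner_nonneg_left y
  rw [inner_evalAt_one_sub_star_mul hX] at h1
  exact le_of_sq_le_sq (by linarith) (norm_nonneg _)

lemma isPositive_compression_iff [FiniteDimensional ℝ E] {X : Fin g → (E →L[ℝ] E)}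
    (hX : IsSymmTuple X) (ζ : E) (β : ℕ) (s : NCPoly g) :
    (orbitProj X ζ β * (1 - evalAt X (star s) * evalAt X s) * orbitProj X ζ β).IsPositive ↔
      ∀ f ∈ degLE g β, ‖evalAt X (s * f) ζ‖ ≤ ‖evalAt X f ζ‖ := by
  have h0 : 1 - evalAt X (star s) * evalAt X s = evalAt X (1 - star s * s) := by simp
  rw [h0]
  have hproj : ∀ x y, inner ℝ (orbitProj X ζ β x) y = inner ℝ x (orbitProj X ζ β y) :=
    (orbitSpace X ζ β).starProjection_isSymmetric
  have hmem : ∀ x, orbitProj X ζ β x ∈ orbitSpace X ζ β :=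
    fun x => (orbitSpace X ζ β).starProjection_apply_mem x
  constructor
  · intro h f hf
    have h1 := h.inner_nonneg_left (evalAt X f ζ)
    have h2 : orbitProj X ζ β (evalAt X f ζ) = evalAt X f ζ :=
      Submodule.starProjection_eq_self_iff.2 (mem_orbitSpace.2 ⟨f, hf, rfl⟩)
    simp only [mul_apply_eq_comp, hproj, h2, inner_evalAt_one_sub_star_mul hX] at h1
    rw [map_mul, mul_apply_eq_comp]
    exact le_of_sq_le_sq (by linarith) (norm_nonneg _)
  · intro h
    rw [ContinuousLinearMap.isPositive_iff]
    constructor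
    · intro x y
      have := inner_evalAt_left hX (1 - star s * s) (orbitProj X ζ β x) (orbitProj X ζ β y)
      simp only [ContinuousLinearMap.coe_coe, mul_apply_eq_comp, hproj]
      rw [this, ← hproj]
      simp
    · intro x
      simp only [mul_apply_eq_comp, hproj, inner_evalAt_one_sub_star_mul hX]
      obtain ⟨f, hf, hfx⟩ := mem_orbitSpace.1 (hmem x)
      have h1 := h f hf
      rw [map_mul, mul_apply_eq_comp, hfx] at h1
      rw [sub_nonneg]
      gcongr

/-- Transport of a tuple of operators along a linear isometry equivalence. -/
def conjTuple (Ψ : E ≃ₗᵢ[ℝ] F) (X : Fin g → (E →L[ℝ] E)) : Fin g → (F →L[ℝ] F) :=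
  fun i => Ψ.toContinuousLinearEquiv.conjContinuousAlgEquiv (X i)

lemma evalAt_conjTuple_apply (Ψ : E ≃ₗᵢ[ℝ] F) (X : Fin g → (E →L[ℝ] E)) (f : NCPoly g) (y : E) :
    evalAt (conjTuple Ψ X) f (Ψ y) = Ψ (evalAt X f y) := by
  induction f using FreeAlgebra.induction generalizing y with
  | grade0 r => simp [Algebra.algebraMap_eq_smul_one]
  | grade1 i => simp [conjTuple]
  | mul a b ha hb => simp [ha, hb]
  | add a b ha hb => simp [ha, hb]

lemma IsSymmTuple.conjTuple {X : Fin g → (E →L[ℝ] E)} (hX : IsSymmTuple X) (Ψ : E ≃ₗᵢ[ℝ] F) :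
    IsSymmTuple (conjTuple Ψ X) := by
  intro i x y
  obtain ⟨x, rfl⟩ := Ψ.surjective x
  obtain ⟨y, rfl⟩ := Ψ.surjective y
  have h := hX i x y
  have h1 := fun z => evalAt_conjTuple_apply Ψ X (FreeAlgebra.ι ℝ i) z
  simp only [evalAt_ι] at h1
  simp only [ContinuousLinearMap.coe_coe] at h ⊢
  rw [h1, h1, Ψ.inner_map_map, Ψ.inner_map_map, h]

lemma norm_conjTuple_le (Ψ : E ≃ₗᵢ[ℝ] F) (X : Fin g → (E →L[ℝ] E)) (i : Fin g) :
    ‖conjTuple Ψ X i‖ ≤ ‖X i‖ := by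
  refine ContinuousLinearMap.opNorm_le_bound _ (norm_nonneg _) fun y => ?_
  obtain ⟨y, rfl⟩ := Ψ.surjective y
  have h1 := evalAt_conjTuple_apply Ψ X (FreeAlgebra.ι ℝ i) y
  simp only [evalAt_ι] at h1
  rw [h1, Ψ.norm_map, Ψ.norm_map]
  exact (X i).le_opNorm y

/-- The neighborhood condition, on an arbitrary finite-dimensional space, as a contraction
property. -/
lemma ContainsNCNhd.exists_contraction {S : Finset (NCPoly g)}
    (h : ContainsNCNhd (complSquares S)) :
    ∃ ε : ℝ, 0 < ε ∧ ∀ (E : Type) [NormedAddCommGroup E] [InnerProductSpace ℝ E]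
      [FiniteDimensional ℝ E] (X : Fin g → (E →L[ℝ] E)), IsSymmTuple X →
      Real.sqrt (∑ i, ‖X i‖ ^ 2) < ε → ∀ s ∈ S, ∀ y, ‖evalAt X s y‖ ≤ ‖y‖ := by
  obtain ⟨ε, hε, h⟩ := h
  refine ⟨ε, hε, fun E _ _ _ X hX hn s hs y => ?_⟩
  let Ψ := (stdOrthonormalBasis ℝ E).repr
  have h1 := h _ (conjTuple Ψ X) (hX.conjTuple Ψ) (lt_of_le_of_lt (Real.sqrt_le_sqrt
    (Finset.sum_le_sum fun i _ => by gcongr; exact norm_conjTuple_le Ψ X i)) hn)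
  have h3 := norm_evalAt_le_of_isPositive (hX.conjTuple Ψ) (h1.2 _ ⟨s, hs, rfl⟩) (Ψ y)
  rwa [evalAt_conjTuple_apply, Ψ.norm_map, Ψ.norm_map] at h3

/-- Elements of the truncated quadratic module have nonnegative values at every tuple that is
contractive on the orbit space. -/
lemma inner_evalAt_nonneg_of_mem_quadModule {α β : ℕ} {S : Finset (NCPoly g)} {p : NCPoly g}
    (hp : p ∈ quadModule α β (complSquares S)) {X : Fin g → (E →L[ℝ] E)} (hX : IsSymmTuple X)
    {ζ : E} (h : ∀ s ∈ S, ∀ f ∈ degLE g β, ‖evalAt X (s * f) ζ‖ ≤ ‖evalAt X f ζ‖) :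
    0 ≤ inner ℝ (evalAt X p ζ) ζ := by
  obtain ⟨u, hu, v, hv, rfl⟩ := hp
  rw [map_add, add_apply, inner_add_left]
  refine add_nonneg ?_ ?_
  · refine AddSubmonoid.closure_induction ?_ ?_ ?_ hu
    · rintro _ ⟨f, hf, rfl⟩
      rw [inner_evalAt_star_mul hX]
      exact real_inner_self_nonneg
    · simp
    · intro x y _ _ hx hy
      rw [map_add, add_apply, inner_add_left]
      exact add_nonneg hx hy
  · refine AddSubmonoid.closure_induction ?_ ?_ ?_ hv
    · rintro _ ⟨_, ⟨s, hs, rfl⟩, f, hf, rfl⟩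
      have h1 : star f * (1 - star s * s) * f = star f * f - star (s * f) * (s * f) := by
        rw [star_mul]; noncomm_ring
      rw [h1, map_sub, sub_apply, inner_sub_left, inner_evalAt_star_mul hX,
        inner_evalAt_star_mul hX, real_inner_self_eq_norm_sq, real_inner_self_eq_norm_sq, sub_nonneg]
      gcongr
      exact h s hs f hf
    · simp
    · intro x y _ _ hx hy
      rw [map_add, add_apply, inner_add_left]
      exact add_nonneg hx hy

end Evaluation

section Separation

section ConvexCone

variable {V : Type*} [NormedAddCommGroup V] [NormedSpace ℝ V]

/-- In finite dimension the convex hull of a compact set is compact. -/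
lemma isCompact_convexHull [FiniteDimensional ℝ V] {K : Set V} (hK : IsCompact K) :
    IsCompact (convexHull ℝ K) := by
  classical
  rcases K.eq_empty_or_nonempty with rfl | ⟨k₀, hk₀⟩
  · simp
  let n := Module.finrank ℝ V + 1
  let Φ : (Fin n → ℝ) × (Fin n → V) → V := fun x => ∑ i, x.1 i • x.2 i
  have hΦ : Continuous Φ := by fun_prop
  have hcomp : IsCompact (stdSimplex ℝ (Fin n) ×ˢ Set.univ.pi fun _ : Fin n => K) :=
    (isCompact_stdSimplex ℝ (Fin n)).prod (isCompact_univ_pi fun _ => hK)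
  convert hcomp.image hΦ using 1
  ext x
  constructor
  · intro hx
    obtain ⟨ι, _, z, w, hz, haff, hw, hw1, rfl⟩ := eq_pos_convex_span_of_mem_convexHull hx
    have hcard : Fintype.card ι ≤ Fintype.card (Fin n) := by
      rw [Fintype.card_fin]
      refine haff.card_le_finrank_succ.trans ?_
      exact Nat.succ_le_succ (Submodule.finrank_le _)
    obtain ⟨e⟩ := Function.Embedding.nonempty_of_card_le hcard
    refine ⟨(Function.extend e w 0, Function.extend e z fun _ => k₀), ⟨⟨fun j => ?_, ?_⟩,
      fun j _ => ?_⟩, ?_⟩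
    · by_cases hj : ∃ i, e i = j
      · obtain ⟨i, rfl⟩ := hj
        simpa [e.injective.extend_apply] using (hw i).le
      · simp [Function.extend_apply' _ _ _ hj]
    · rw [← hw1]
      refine (Fintype.sum_of_injective e e.injective _ _ (fun j hj => ?_) fun i => ?_).symm
      · simp [Function.extend_apply' _ _ _ hj]
      · simp [e.injective.extend_apply]
    · by_cases hj : ∃ i, e i = j
      · obtain ⟨i, rfl⟩ := hj
        simpa [e.injective.extend_apply] using hz ⟨i, rfl⟩
      · simpa [Function.extend_apply' _ _ _ hj] using hk₀
    · refine (Fintype.sum_of_injective e e.injective _ _ (fun j hj => ?_) fun i => ?_).symm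
      · simp [Function.extend_apply' _ _ _ hj]
      · simp [e.injective.extend_apply]
  · rintro ⟨⟨w, z⟩, ⟨hw, hz⟩, rfl⟩
    exact (convex_convexHull ℝ K).sum_mem (fun i _ => hw.1 i) hw.2
      fun i _ => subset_convexHull ℝ K (hz i trivial)

/-- The cone over a compact set on which a continuous functional is positive is closed. -/
lemma isClosed_cone_of_isCompact {D : Set V} (hD : IsCompact D)
    (L : V →L[ℝ] ℝ) (hL : ∀ y ∈ D, 0 < L y) :
    IsClosed {x | ∃ r : ℝ, 0 ≤ r ∧ ∃ y ∈ D, x = r • y} := by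
  have : CompactSpace D := isCompact_iff_compactSpace.1 hD
  have hclosed : IsClosed {z : D × V | 0 ≤ L z.2 ∧ L z.1 • z.2 = L z.2 • (z.1 : V)} := by
    have h1 : IsClosed {z : D × V | 0 ≤ L z.2} := isClosed_le (by fun_prop) (by fun_prop)
    have h2 : IsClosed {z : D × V | L z.1 • z.2 = L z.2 • (z.1 : V)} :=
      isClosed_eq (by fun_prop) (by fun_prop)
    exact h1.inter h2
  convert isClosedMap_snd_of_compactSpace _ hclosed using 1
  ext x
  constructor
  · rintro ⟨r, hr, y, hy, rfl⟩
    refine ⟨(⟨y, hy⟩, r • y), ⟨?_, ?_⟩, rfl⟩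
    · simpa using mul_nonneg hr (hL y hy).le
    · simp [smul_smul, mul_comm]
  · rintro ⟨⟨⟨y, hy⟩, x⟩, ⟨h1, h2⟩, rfl⟩
    refine ⟨L x / L y, div_nonneg h1 (hL y hy).le, y, hy, ?_⟩
    simp only at h2
    rw [div_eq_inv_mul, mul_smul, ← h2, inv_smul_smul₀ (hL y hy).ne']

/-- A point outside the convex cone generated by a compact set, on which some functional is
positive, can be strictly separated from it. -/
lemma exists_separating_of_isCompact [FiniteDimensional ℝ V] {K : Set V} (hK : IsCompact K)
    (hne : K.Nonempty) (L : V →L[ℝ] ℝ) (hL : ∀ k ∈ K, 0 < L k) {p : V}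
    (hp : p ∉ AddSubmonoid.closure {x | ∃ r : ℝ, 0 ≤ r ∧ ∃ k ∈ K, x = r • k}) :
    ∃ ℓ : V →L[ℝ] ℝ, (∀ k ∈ K, 0 ≤ ℓ k) ∧ ℓ p < 0 := by
  set N := AddSubmonoid.closure {x | ∃ r : ℝ, 0 ≤ r ∧ ∃ k ∈ K, x = r • k}
  have hconv := convex_convexHull ℝ K
  have hneD : (convexHull ℝ K).Nonempty := hne.mono (subset_convexHull ℝ K)
  have hLD : ∀ y ∈ convexHull ℝ K, 0 < L y := by
    intro y hy
    have : convexHull ℝ K ⊆ {y | 0 < L y} :=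
      convexHull_min hL (convex_halfSpace_gt L.toLinearMap.isLinear 0)
    exact this hy
  let C : ProperCone ℝ V :=
    { carrier := {x | ∃ r : ℝ, 0 ≤ r ∧ ∃ y ∈ convexHull ℝ K, x = r • y}
      zero_mem' := by
        obtain ⟨y, hy⟩ := hneD
        exact ⟨0, le_rfl, y, hy, by simp⟩
      add_mem' := by
        rintro _ _ ⟨r, hr, y, hy, rfl⟩ ⟨r', hr', y', hy', rfl⟩
        rcases (add_nonneg hr hr').eq_or_lt with h | h
        · have h1 : r = 0 := by linarith
          have h2 : r' = 0 := by linarith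
          exact ⟨0, le_rfl, y, hy, by simp [h1, h2]⟩
        · refine ⟨r + r', h.le, (r / (r + r')) • y + (r' / (r + r')) • y',
            hconv hy hy' (by positivity) (by positivity) (by field_simp), ?_⟩
          rw [smul_add, smul_smul, smul_smul, mul_div_cancel₀ _ h.ne', mul_div_cancel₀ _ h.ne']
      smul_mem' := by
        rintro c _ ⟨r, hr, y, hy, rfl⟩
        exact ⟨c * r, mul_nonneg c.2 hr, y, hy, by rw [mul_smul]; rfl⟩
      isClosed' := isClosed_cone_of_isCompact (isCompact_convexHull hK) L hLD }
  have hN_smul : ∀ (r : ℝ), 0 ≤ r → ∀ y ∈ N, r • y ∈ N := by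
    intro r hr y hy
    refine AddSubmonoid.closure_induction ?_ ?_ ?_ hy
    · rintro _ ⟨r', hr', k, hk, rfl⟩
      exact AddSubmonoid.subset_closure ⟨r * r', mul_nonneg hr hr', k, hk, by rw [mul_smul]⟩
    · simp
    · intro a b _ _ ha hb
      rw [smul_add]
      exact add_mem ha hb
  have hDN : convexHull ℝ K ⊆ N := by
    refine convexHull_min (fun k hk => AddSubmonoid.subset_closure ⟨1, zero_le_one, k, hk,
      (one_smul ℝ k).symm⟩) ?_
    intro x hx y hy a b ha hb _
    exact add_mem (hN_smul a ha x hx) (hN_smul b hb y hy)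
  have hpC : p ∉ C := by
    rintro ⟨r, hr, y, hy, rfl⟩
    exact hp (hN_smul r hr y (hDN hy))
  obtain ⟨ℓ, hℓ, hℓp⟩ := C.hyperplane_separation_point hpC
  exact ⟨ℓ, fun k hk => hℓ k ⟨1, zero_le_one, k, subset_convexHull ℝ K hk, (one_smul ℝ k).symm⟩,
    hℓp⟩

end ConvexCone

/-- Separation from the cone generated by the diagonals of finitely many bilinear maps, on which
some functional is positive definite. -/
lemma exists_separating_of_bilinear {V J : Type*} [AddCommGroup V] [Module ℝ V]
    [FiniteDimensional ℝ V] [Finite J] (U : J → Type*) [∀ j, AddCommGroup (U j)]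
    [∀ j, Module ℝ (U j)] [∀ j, FiniteDimensional ℝ (U j)] (b : ∀ j, U j →ₗ[ℝ] U j →ₗ[ℝ] V)
    (L : V →ₗ[ℝ] ℝ) (hL : ∀ j u, u ≠ 0 → 0 < L (b j u u)) (hne : ∃ j, ∃ u : U j, u ≠ 0)
    {p : V} (hp : p ∉ AddSubmonoid.closure {x | ∃ j u, x = b j u u}) :
    ∃ ℓ : V →ₗ[ℝ] ℝ, (∀ j u, 0 ≤ ℓ (b j u u)) ∧ ℓ p < 0 := by
  let φ : V ≃ₗ[ℝ] _ := (Module.finBasis ℝ V).equivFun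
  let e : ∀ j, U j ≃ₗ[ℝ] _ := fun j => (Module.finBasis ℝ (U j)).equivFun
  let q : ∀ j, (Fin (Module.finrank ℝ (U j)) → ℝ) → _ :=
    fun j u => φ (b j ((e j).symm u) ((e j).symm u))
  have hq : ∀ j, Continuous (q j) := by
    intro j
    let B : (Fin (Module.finrank ℝ (U j)) → ℝ) →ₗ[ℝ]
        ((Fin (Module.finrank ℝ (U j)) → ℝ) →L[ℝ] (Fin (Module.finrank ℝ V) → ℝ)) :=
      (LinearMap.toContinuousLinearMap : _ ≃ₗ[ℝ] _).toLinearMap ∘ₗ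
        (((b j).compl₁₂ (e j).symm.toLinearMap (e j).symm.toLinearMap).compr₂ φ.toLinearMap)
    exact (B.continuous_of_finiteDimensional).clm_apply continuous_id
  have hqsmul : ∀ j (r : ℝ) u, q j (r • u) = (r * r) • q j u := by
    intro j r u
    simp [q, smul_smul]
  let K : Set (Fin (Module.finrank ℝ V) → ℝ) := ⋃ j, q j '' Metric.sphere 0 1
  have hK : IsCompact K := isCompact_iUnion fun j => (isCompact_sphere 0 1).image (hq j)
  have hscale : ∀ j (u : U j), u ≠ 0 → ∃ r : ℝ, 0 ≤ r ∧ ∃ k ∈ K, φ (b j u u) = r • k := by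
    intro j u hu
    have hu' : e j u ≠ 0 := by simpa using hu
    have hn : ‖e j u‖ ≠ 0 := norm_ne_zero_iff.2 hu'
    refine ⟨‖e j u‖ * ‖e j u‖, by positivity, q j (‖e j u‖⁻¹ • e j u),
      Set.mem_iUnion.2 ⟨j, _, by simp [norm_smul, hn], rfl⟩, ?_⟩
    rw [← hqsmul, smul_inv_smul₀ hn]
    simp [q]
  let L' := LinearMap.toContinuousLinearMap (L ∘ₗ φ.symm.toLinearMap)
  have hL' : ∀ k ∈ K, 0 < L' k := by
    intro k hk
    obtain ⟨j, u, hu, rfl⟩ := Set.mem_iUnion.1 hk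
    have hu0 : u ≠ 0 := by
      rintro rfl
      simp at hu
    simpa [L', q] using hL j ((e j).symm u) (by simpa using hu0)
  have hKne : K.Nonempty := by
    obtain ⟨j, u, hu⟩ := hne
    obtain ⟨_, _, k, hk, _⟩ := hscale j u hu
    exact ⟨k, hk⟩
  have hp' : φ p ∉ AddSubmonoid.closure {x | ∃ r : ℝ, 0 ≤ r ∧ ∃ k ∈ K, x = r • k} := by
    intro h
    apply hp
    have hle : AddSubmonoid.closure {x | ∃ r : ℝ, 0 ≤ r ∧ ∃ k ∈ K, x = r • k} ≤
        (AddSubmonoid.closure {x | ∃ j u, x = b j u u}).comap φ.symm.toLinearMap.toAddMonoidHom := by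
      refine (AddSubmonoid.closure_le).2 ?_
      rintro _ ⟨r, hr, k, hk, rfl⟩
      obtain ⟨j, u, _, rfl⟩ := Set.mem_iUnion.1 hk
      refine AddSubmonoid.subset_closure ⟨j, (e j).symm (Real.sqrt r • u), ?_⟩
      simp [q, smul_smul, Real.mul_self_sqrt hr]
    simpa using hle h
  obtain ⟨ℓ, hℓ, hℓp⟩ := exists_separating_of_isCompact hK hKne L' hL' hp'
  refine ⟨ℓ.toLinearMap ∘ₗ φ.toLinearMap, fun j u => ?_, by simpa using hℓp⟩
  by_cases hu : u = 0
  · simp [hu]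
  · obtain ⟨r, hr, k, hk, h⟩ := hscale j u hu
    simpa [h] using mul_nonneg hr (hℓ k hk)

end Separation

section GNS

universe w

/-- A positive definite symmetric bilinear form on a finite-dimensional space is the inner product
of a Euclidean space, which can be taken in any universe. -/
lemma exists_linearEquiv_euclideanSpace {U : Type*} [AddCommGroup U] [Module ℝ U]
    [FiniteDimensional ℝ U] (B : U →ₗ[ℝ] U →ₗ[ℝ] ℝ) (hsymm : ∀ u v, B u v = B v u)
    (hpos : ∀ u, u ≠ 0 → 0 < B u u) :
    ∃ Φ : U ≃ₗ[ℝ] EuclideanSpace ℝ (ULift.{w} (Fin (Module.finrank ℝ U))),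
      ∀ u v, inner ℝ (Φ u) (Φ v) = B u v := by
  let core : InnerProductSpace.Core ℝ U :=
    { inner := fun u v => B u v
      conj_inner_symm := fun u v => hsymm v u
      re_inner_nonneg := fun u => by
        by_cases hu : u = 0
        · simp [hu]
        · exact (hpos u hu).le
      add_left := fun u v w => by simp
      smul_left := fun u v r => by simp
      definite := fun u hu => by
        by_contra h
        exact (hpos u h).ne' hu }
  let _ : NormedAddCommGroup U := core.toNormedAddCommGroup
  let _ : InnerProductSpace ℝ U := InnerProductSpace.ofCore core.toCore
  exact ⟨((stdOrthonormalBasis ℝ U).reindex Equiv.ulift.symm).repr.toLinearEquiv,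
    fun u v => ((stdOrthonormalBasis ℝ U).reindex Equiv.ulift.symm).repr.inner_map_map u v⟩

lemma exists_operator_of_bilinear {E : Type*} [NormedAddCommGroup E] [InnerProductSpace ℝ E]
    [FiniteDimensional ℝ E] (C : E →ₗ[ℝ] E →ₗ[ℝ] ℝ) :
    ∃ T : E →L[ℝ] E, ∀ y z, inner ℝ (T y) z = C y z := by
  have : CompleteSpace E := FiniteDimensional.complete ℝ E
  let T : E →ₗ[ℝ] E :=
    { toFun := fun y => (InnerProductSpace.toDual ℝ E).symm (LinearMap.toContinuousLinearMap (C y))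
      map_add' := fun y z => by simp
      map_smul' := fun r y => by simp }
  exact ⟨LinearMap.toContinuousLinearMap T, fun y z => by simp [T]⟩

variable {g : ℕ}

/-- The Gelfand–Naimark–Segal construction for a symmetric functional that is positive on
the squares of degree at most `2 * m + 2`, with the operators compressed to degree `m`. -/
theorem exists_gns {m : ℕ} (L : NCPoly g →ₗ[ℝ] ℝ) (hsymm : ∀ f, L (star f) = L f)
    (hpos : ∀ f ∈ degLE g (m + 1), f ≠ 0 → 0 < L (star f * f)) :
    ∃ (X : Fin g → (EuclideanSpace ℝ (ULift.{w} (Fin (sigmaDim g m))) →L[ℝ]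
        EuclideanSpace ℝ (ULift.{w} (Fin (sigmaDim g m)))))
      (ζ : EuclideanSpace ℝ (ULift.{w} (Fin (sigmaDim g m)))), IsSymmTuple X ∧
      (∀ f ∈ degLE g (2 * m + 1), inner ℝ (evalAt X f ζ) ζ = L f) ∧
      ∀ h ∈ degLE g (m + 1), ‖evalAt X h ζ‖ ^ 2 ≤ L (star h * h) := by
  have hsymm' : ∀ u v : NCPoly g, L (star u * v) = L (star v * u) := fun u v => by
    rw [← hsymm, star_mul, star_star]
  let B : degLE g m →ₗ[ℝ] degLE g m →ₗ[ℝ] ℝ := LinearMap.mk₂ ℝ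
    (fun u v => L (star (u : NCPoly g) * v)) (fun u u' v => by simp [add_mul])
    (fun r u v => by simp [star_smul_poly]) (fun u v v' => by simp [mul_add])
    (fun r u v => by simp)
  obtain ⟨Φ, hΦ⟩ := exists_linearEquiv_euclideanSpace.{w} B (fun u v => hsymm' _ _)
    (fun u hu => hpos u (degLE_mono (Nat.le_succ m) u.2) (by simpa using hu))
  change degLE g m ≃ₗ[ℝ] EuclideanSpace ℝ (ULift.{w} (Fin (sigmaDim g m))) at Φ
  have hΦ' : ∀ u v, inner ℝ (Φ u) (Φ v) = L (star (u : NCPoly g) * v) := hΦ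
  have hC : ∀ i : Fin g, ∃ T : EuclideanSpace ℝ (ULift.{w} (Fin (sigmaDim g m))) →L[ℝ]
      EuclideanSpace ℝ (ULift.{w} (Fin (sigmaDim g m))), ∀ u v, inner ℝ (T (Φ u)) (Φ v) =
        L (star (v : NCPoly g) * (FreeAlgebra.ι ℝ i * u)) := by
    intro i
    obtain ⟨T, hT⟩ := exists_operator_of_bilinear (LinearMap.mk₂ ℝ
      (fun y z => L (star (Φ.symm z : NCPoly g) * (FreeAlgebra.ι ℝ i * (Φ.symm y : NCPoly g))))
      (fun u u' v => by simp [mul_add]) (fun r u v => by simp)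
      (fun u v v' => by simp [add_mul]) (fun r u v => by simp [star_smul_poly]))
    exact ⟨T, fun u v => by simp [hT]⟩
  choose X hX using hC
  have hsymmX : IsSymmTuple X := by
    intro i y z
    obtain ⟨u, rfl⟩ := Φ.surjective y
    obtain ⟨v, rfl⟩ := Φ.surjective z
    simp only [ContinuousLinearMap.coe_coe]
    rw [hX, real_inner_comm, hX, hsymm']
    simp [mul_assoc]
  let ζ := Φ ⟨1, one_mem_degLE m⟩
  have hext : ∀ (v : NCPoly g) (hv : v ∈ degLE g m),
      (∀ u, inner ℝ (evalAt X v ζ) (Φ u) = L (star (u : NCPoly g) * v)) →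
      evalAt X v ζ = Φ ⟨v, hv⟩ := by
    intro v hv h
    refine ext_inner_right ℝ fun z => ?_
    obtain ⟨u, rfl⟩ := Φ.surjective z
    rw [h, hΦ', hsymm']
  have hword : ∀ l : List (Fin g), l.length ≤ m + 1 → ∀ u,
      inner ℝ (evalAt X (word l) ζ) (Φ u) = L (star (u : NCPoly g) * word l) := by
    intro l
    induction l with
    | nil =>
      intro _ u
      simp [ζ, hΦ', hsymm]
    | cons i l ih =>
      intro hl u
      simp only [List.length_cons, Nat.add_le_add_iff_right] at hl
      rw [evalAt_word_cons_apply, hext _ (word_mem_degLE hl) (ih (by omega)), hX, word_cons]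
  have hpoly : ∀ v ∈ degLE g (m + 1), ∀ u,
      inner ℝ (evalAt X v ζ) (Φ u) = L (star (u : NCPoly g) * v) := by
    intro v hv u
    refine Submodule.span_induction ?_ ?_ ?_ ?_ hv
    · rintro _ ⟨l, hl, rfl⟩
      exact hword l hl u
    · simp
    · intro x y _ _ hx hy
      simp [inner_add_left, mul_add, hx, hy]
    · intro r x _ hx
      simp [inner_smul_left, hx]
  have heval : ∀ (u : NCPoly g) (hu : u ∈ degLE g m), evalAt X u ζ = Φ ⟨u, hu⟩ :=
    fun u hu => hext u hu (hpoly u (degLE_mono (Nat.le_succ m) hu))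
  refine ⟨X, ζ, hsymmX, fun f hf => ?_, fun h hh => ?_⟩
  · refine Submodule.span_induction ?_ ?_ ?_ ?_ hf
    · rintro _ ⟨l, hl, rfl⟩
      obtain ⟨u, v, hu, hv, huv⟩ := exists_word_eq_star_mul (j := m) (k := m + 1)
        (show l.length ≤ _ by omega)
      rw [huv, inner_evalAt_star_mul hsymmX, heval _ (word_mem_degLE hu),
        hpoly _ (word_mem_degLE hv)]
    · simp
    · intro x y _ _ hx hy
      simp [inner_add_left, hx, hy]
    · intro r x _ hx
      simp [inner_smul_left, hx]
  · obtain ⟨u, hu⟩ := Φ.surjective (evalAt X h ζ)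
    have h1 : ‖evalAt X h ζ‖ ^ 2 = L (star (u : NCPoly g) * h) := by
      rw [← hpoly h hh, hu, real_inner_self_eq_norm_sq]
    have h2 : ‖evalAt X h ζ‖ ^ 2 = L (star (u : NCPoly g) * u) := by
      rw [← hΦ', hu, real_inner_self_eq_norm_sq]
    have h3 : 0 ≤ L (star (h - u) * (h - u)) := by
      by_cases h0 : h - (u : NCPoly g) = 0
      · simp [h0]
      · exact (hpos _ (sub_mem hh (degLE_mono (Nat.le_succ m) u.2)) h0).le
    have h4 : L (star (h - u) * (h - u)) = L (star h * h) - L (star (h : NCPoly g) * u) -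
        L (star (u : NCPoly g) * h) + L (star (u : NCPoly g) * u) := by
      rw [star_sub, sub_mul, mul_sub, mul_sub]
      simp only [map_sub]
      ring
    rw [hsymm' h u] at h4
    linarith

end GNS

section Fock

open Filter Topology

variable {g m : ℕ}

/-- The words of length at most `m`. -/
abbrev Words (g m : ℕ) : Type := {l : List (Fin g) // l.length ≤ m}

instance fintypeWords (g m : ℕ) : Fintype (Words g m) := Fintype.ofFinite _

/-- A weighted creation operator plus its adjoint on the truncated Fock space, perturbed by a
matrix. -/
def fockOp (ρ : List (Fin g) → ℝ) (A : Fin g → Matrix (Words g m) (Words g m) ℝ) (i : Fin g) :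
    EuclideanSpace ℝ (Words g m) →L[ℝ] EuclideanSpace ℝ (Words g m) :=
  Matrix.toEuclideanCLM (𝕜 := ℝ) (Matrix.of fun u v : Words g m =>
    (if u.1 = i :: v.1 then ρ u.1 else 0) + (if v.1 = i :: u.1 then ρ v.1 else 0) + A i u v)

/-- The weighted vacuum vector. -/
def vacuum (m : ℕ) (ρ : List (Fin g) → ℝ) : EuclideanSpace ℝ (Words g m) :=
  EuclideanSpace.single ⟨[], Nat.zero_le m⟩ (ρ [])

/-- The product of the weights of all suffixes of a word. -/
def suffixWeight (ρ : List (Fin g) → ℝ) : List (Fin g) → ℝ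
  | [] => ρ []
  | i :: l => ρ (i :: l) * suffixWeight ρ l

variable {ρ : List (Fin g) → ℝ} {A : Fin g → Matrix (Words g m) (Words g m) ℝ}

lemma fockOp_apply (i : Fin g) (y : EuclideanSpace ℝ (Words g m)) (u : Words g m) :
    fockOp ρ A i y u = ((∑ v : Words g m, if u.1 = i :: v.1 then ρ u.1 * y v else 0) +
      ∑ v : Words g m, if v.1 = i :: u.1 then ρ v.1 * y v else 0) + ∑ v, A i u v * y v := by
  simp only [fockOp, Matrix.ofLp_toEuclideanCLM, Matrix.mulVec, dotProduct, Matrix.of_apply,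
    ← Finset.sum_add_distrib]
  refine Finset.sum_congr rfl fun v _ => ?_
  split_ifs <;> ring

lemma isSymmTuple_fockOp (hA : ∀ i, (A i).IsSymm) : IsSymmTuple (fockOp ρ A) := by
  have key : ∀ i u v, (Matrix.of fun u v : Words g m => (if u.1 = i :: v.1 then ρ u.1 else 0) +
      (if v.1 = i :: u.1 then ρ v.1 else 0) + A i u v) u v = (Matrix.of fun u v : Words g m =>
      (if u.1 = i :: v.1 then ρ u.1 else 0) +
      (if v.1 = i :: u.1 then ρ v.1 else 0) + A i u v) v u := by
    intro i u v
    simp only [Matrix.of_apply]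
    rw [(hA i).apply v u]
    ring
  intro i x y
  simp only [ContinuousLinearMap.coe_coe, fockOp]
  rw [Matrix.inner_toEuclideanCLM, real_inner_comm, Matrix.inner_toEuclideanCLM,
    Matrix.dotProduct_mulVec, ← Matrix.mulVec_transpose, dotProduct_comm]
  congr 2
  ext u v
  exact key i v u

/-- The leading coordinates of a word applied to the vacuum. -/
lemma evalAt_word_vacuum_apply (hA : ∀ i u v, v.1.length < m → A i u v = 0)
    (l : List (Fin g)) (hl : l.length ≤ m) (u : Words g m) (hu : l.length ≤ u.1.length) :
    evalAt (fockOp ρ A) (word l) (vacuum m ρ) u = if u.1 = l then suffixWeight ρ l else 0 := by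
  induction l generalizing u with
  | nil => simp [vacuum, suffixWeight, PiLp.single_apply, Subtype.ext_iff]
  | cons i l ih =>
    simp only [List.length_cons] at hl hu
    rw [evalAt_word_cons_apply, fockOp_apply]
    set y := evalAt (fockOp ρ A) (word l) (vacuum m ρ)
    have ih' : ∀ v : Words g m, l.length ≤ v.1.length →
        y v = if v.1 = l then suffixWeight ρ l else 0 := fun v hv => ih (by omega) v hv
    have h3 : ∑ v, A i u v * y v = 0 := by
      refine Finset.sum_eq_zero fun v _ => ?_
      rcases Nat.lt_or_ge v.1.length m with hv | hv
      · rw [hA i u v hv, zero_mul]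
      · rw [ih' v (by omega), if_neg (fun h => by rw [h] at hv; omega), mul_zero]
    have h2 : (∑ v : Words g m, if v.1 = i :: u.1 then ρ v.1 * y v else 0) = 0 := by
      refine Finset.sum_eq_zero fun v _ => ?_
      split_ifs with hv
      · have hlen : v.1.length = u.1.length + 1 := by rw [hv]; simp
        rw [ih' v (by omega), if_neg (fun h => by rw [h] at hlen; omega), mul_zero]
      · rfl
    rw [h2, h3, add_zero, add_zero]
    split_ifs with h
    · rw [Finset.sum_eq_single ⟨l, by omega⟩]
      · rw [if_pos h, ih' _ le_rfl, if_pos rfl, h, suffixWeight]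
      · intro v _ hv
        rw [if_neg]
        intro h'
        rw [h'] at h
        exact hv (Subtype.ext (List.cons.inj h).2)
      · simp
    · refine Finset.sum_eq_zero fun v _ => ?_
      split_ifs with hv
      · have hlen : u.1.length = v.1.length + 1 := by rw [hv]; simp
        rw [ih' v (by omega), if_neg (fun h' => h (by rw [hv, h'])), mul_zero]
      · rfl

/-- A polynomial of degree less than the length of `u` does not reach the coordinate `u`. -/
lemma evalAt_vacuum_apply_eq_zero (hA : ∀ i u v, v.1.length < m → A i u v = 0) {k : ℕ}
    {f : NCPoly g} (hf : f ∈ degLE g k) (u : Words g m) (hu : k < u.1.length) :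
    evalAt (fockOp ρ A) f (vacuum m ρ) u = 0 := by
  refine Submodule.span_induction ?_ ?_ ?_ ?_ hf
  · rintro _ ⟨l, hl, rfl⟩
    have := u.2
    rw [evalAt_word_vacuum_apply hA l (by omega) u (by omega), if_neg]
    rintro h
    rw [h] at hu
    omega
  · simp
  · intro x y _ _ hx hy
    simp [hx, hy]
  · intro r x _ hx
    simp [hx]

lemma suffixWeight_ne_zero (hρ : ∀ l, ρ l ≠ 0) (l : List (Fin g)) : suffixWeight ρ l ≠ 0 := by
  induction l with
  | nil => exact hρ []
  | cons i l ih => exact mul_ne_zero (hρ _) ih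

/-- The vacuum is separating for polynomials of degree at most `m`. -/
lemma eq_zero_of_evalAt_vacuum_eq_zero (hρ : ∀ l, ρ l ≠ 0)
    (hA : ∀ i u v, v.1.length < m → A i u v = 0) {f : NCPoly g} (hf : f ∈ degLE g m)
    (h0 : evalAt (fockOp ρ A) f (vacuum m ρ) = 0) : f = 0 := by
  suffices H : ∀ k ≤ m, ∀ f ∈ degLE g k, evalAt (fockOp ρ A) f (vacuum m ρ) = 0 → f = 0 from
    H m le_rfl f hf h0
  intro k
  induction k with
  | zero =>
    intro _ f hf h0
    obtain ⟨c, rfl⟩ := mem_degLE_zero.1 hf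
    have h1 := congrArg (fun y : EuclideanSpace ℝ (Words g m) => y ⟨[], Nat.zero_le m⟩) h0
    simpa [vacuum, hρ] using h1
  | succ k ih =>
    intro hk f hf h0
    obtain ⟨c, r, hr, rfl⟩ := exists_eq_sum_add_of_mem_degLE_succ hf
    have hc : c = 0 := by
      funext w
      have h1 := congrArg (fun y : EuclideanSpace ℝ (Words g m) =>
        y ⟨w.toList, by rw [w.toList_length]; exact hk⟩) h0
      simp only [map_add, map_sum, map_smul, add_apply, sum_apply, PiLp.add_apply, WithLp.ofLp_sum,
        Finset.sum_apply, smul_apply, PiLp.smul_apply, PiLp.zero_apply] at h1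
      rw [evalAt_vacuum_apply_eq_zero hA hr _ (by simp only [w.toList_length]; omega),
        Finset.sum_eq_single w, evalAt_word_vacuum_apply hA (l := w.toList)
          (by rw [w.toList_length]; exact hk) _ le_rfl] at h1
      · simpa [suffixWeight_ne_zero hρ] using h1
      · intro b _ hb
        rw [evalAt_word_vacuum_apply hA _ (by rw [b.toList_length]; exact hk) _
          (by simp only [List.Vector.toList_length, le_rfl]),
          if_neg (fun h => hb (List.Vector.toList_injective h.symm)), smul_zero]
      · simp
    subst hc
    have := ih (by omega) r hr (by simpa using h0)
    simp [this]

lemma abs_sum_ite_le {ι : Type*} [Fintype ι] {P : ι → Prop} [DecidablePred P]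
    (hP : ∀ v w, P v → P w → v = w) {F : ι → ℝ} {C : ℝ} (hC : 0 ≤ C) (hF : ∀ v, |F v| ≤ C) :
    |∑ v, if P v then F v else 0| ≤ C := by
  by_cases h : ∃ v, P v
  · obtain ⟨v, hv⟩ := h
    rw [Finset.sum_eq_single v, if_pos hv]
    · exact hF v
    · intro w _ hw
      exact if_neg fun h' => hw (hP w v h' hv)
    · simp
  · push Not at h
    simpa [h] using hC

/-- The weighted creation operator and its adjoint are bounded on coordinates. -/
lemma abs_fockOp_apply_sub_le (hρ : ∀ l, |ρ l| ≤ 1) (i : Fin g)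
    {y : EuclideanSpace ℝ (Words g m)} {C : ℝ} (hC : 0 ≤ C) (hy : ∀ v, |y v| ≤ C) (u : Words g m) :
    |fockOp ρ A i y u - ∑ v, A i u v * y v| ≤ 2 * C := by
  have hb : ∀ l v, |ρ l * y v| ≤ C := fun l v => by
    rw [abs_mul]
    exact (mul_le_mul (hρ l) (hy v) (abs_nonneg _) zero_le_one).trans (one_mul C).le
  rw [fockOp_apply, add_sub_cancel_right, two_mul]
  refine (abs_add_le _ _).trans (add_le_add ?_ ?_)
  · refine abs_sum_ite_le (fun v w hv hw => ?_) hC fun v => hb _ v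
    rw [hv] at hw
    exact Subtype.ext (List.cons.inj hw).2
  · refine abs_sum_ite_le (fun v w hv hw => ?_) hC fun v => hb _ v
    exact Subtype.ext (hv.trans hw.symm)

/-- The coordinates of a word of length at most `m` applied to the vacuum are bounded. -/
lemma abs_evalAt_word_vacuum_le (hρ : ∀ l, |ρ l| ≤ 1)
    (hA : ∀ i u v, v.1.length < m → A i u v = 0) (l : List (Fin g)) (hl : l.length ≤ m)
    (u : Words g m) : |evalAt (fockOp ρ A) (word l) (vacuum m ρ) u| ≤ 2 ^ l.length := by
  induction l generalizing u with
  | nil =>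
    simp only [word_nil, map_one, one_apply_eq_self, vacuum, PiLp.single_apply]
    split_ifs <;> simp [hρ]
  | cons i l ih =>
    simp only [List.length_cons] at hl
    have h := abs_fockOp_apply_sub_le (A := A) hρ i (by positivity) (ih (by omega)) u
    rw [Finset.sum_eq_zero, sub_zero] at h
    · rw [evalAt_word_cons_apply, List.length_cons, pow_succ']
      exact h
    · intro v _
      rcases Nat.lt_or_ge v.1.length m with hv | hv
      · rw [hA i u v hv, zero_mul]
      · rw [evalAt_word_vacuum_apply hA l (by omega) v (by omega),
          if_neg (fun h => by rw [h] at hv; omega), mul_zero]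

end Fock

section ConcentratedFock

open Filter Topology

variable {g m : ℕ}

/-- The weights of the Fock space in which one word `w₀` is scaled by `δ`. -/
def spikeWeight (w₀ : List (Fin g)) (δ : ℝ) (l : List (Fin g)) : ℝ :=
  if l = w₀ then δ else 1

/-- A symmetric perturbation on words of length `m` that sends the vector of each word `l` of length
`m` approximately to `δ⁻¹ * c (i :: l)` times the vector of the word `w₀`. -/
def spikeMatrix (c : List (Fin g) → ℝ) (w₀ : List (Fin g)) (δ : ℝ) (i : Fin g) :
    Matrix (Words g m) (Words g m) ℝ :=
  Matrix.of fun u v => if u.1.length = m ∧ v.1.length = m then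
    δ⁻¹ * ((if u.1 = w₀ then c (i :: v.1) * (if v.1 = w₀ then (2 * δ)⁻¹ else 1) else 0) +
      (if v.1 = w₀ then c (i :: u.1) * (if u.1 = w₀ then (2 * δ)⁻¹ else 1) else 0)) else 0

lemma spikeMatrix_isSymm (c : List (Fin g) → ℝ) (w₀ : List (Fin g)) (δ : ℝ) (i : Fin g) :
    (spikeMatrix (m := m) c w₀ δ i).IsSymm := by
  ext u v
  simp only [spikeMatrix, Matrix.transpose_apply, Matrix.of_apply, and_comm (a := v.1.length = m)]
  congr 2
  rw [add_comm]

lemma spikeMatrix_eq_zero (c : List (Fin g) → ℝ) (w₀ : List (Fin g)) (δ : ℝ) (i : Fin g)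
    (u v : Words g m) (hv : v.1.length < m) : spikeMatrix c w₀ δ i u v = 0 := by
  simp [spikeMatrix, hv.ne]

lemma suffixWeight_spikeWeight {w₀ : List (Fin g)} {δ : ℝ} {l : List (Fin g)}
    (hl : l.length ≤ w₀.length) : suffixWeight (spikeWeight w₀ δ) l = spikeWeight w₀ δ l := by
  have h1 : ∀ l : List (Fin g), l.length < w₀.length → suffixWeight (spikeWeight w₀ δ) l = 1 := by
    intro l
    induction l with
    | nil =>
      intro hl
      rw [suffixWeight, spikeWeight, if_neg (by rintro rfl; simp at hl)]
    | cons i l ih =>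
      intro hl
      rw [suffixWeight, ih (by simp at hl; omega), spikeWeight,
        if_neg (by rintro rfl; simp at hl), mul_one]
  cases l with
  | nil => rfl
  | cons i l => rw [suffixWeight, h1 l (by simpa using hl), mul_one]

lemma abs_spikeWeight_le {w₀ : List (Fin g)} {δ : ℝ} (h0 : 0 < δ) (h1 : δ ≤ 1)
    (l : List (Fin g)) : |spikeWeight w₀ δ l| ≤ 1 := by
  rw [spikeWeight]
  split_ifs
  · rwa [abs_of_pos h0]
  · simp

lemma abs_spikeMatrix_mul_sub_le (c : List (Fin g) → ℝ) {w₀ : List (Fin g)} (hw₀ : w₀.length = m)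
    {δ : ℝ} (h0 : 0 < δ) (i : Fin g) (u v : Words g m) (hv : v.1.length = m) :
    |δ * (spikeMatrix c w₀ δ i u v * spikeWeight w₀ δ v.1) -
      if u.1 = w₀ then c (i :: v.1) else 0| ≤ δ * |c (i :: u.1)| := by
  have hδ := h0.ne'
  by_cases hu : u.1 = w₀
  · by_cases hv' : v.1 = w₀
    · have : δ * (spikeMatrix c w₀ δ i u v * spikeWeight w₀ δ v.1) - c (i :: v.1) = 0 := by
        simp only [spikeMatrix, spikeWeight, Matrix.of_apply, hu, hv', hw₀, and_self, if_true]
        field_simp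
        ring
      rw [if_pos hu, this, abs_zero]
      positivity
    · have : δ * (spikeMatrix c w₀ δ i u v * spikeWeight w₀ δ v.1) - c (i :: v.1) = 0 := by
        simp only [spikeMatrix, spikeWeight, Matrix.of_apply, hu, hv, hv', hw₀, and_self, if_true,
          if_false]
        field_simp
        ring
      rw [if_pos hu, this, abs_zero]
      positivity
  · rw [if_neg hu, sub_zero]
    by_cases hum : u.1.length = m
    · by_cases hv' : v.1 = w₀
      · have : δ * (spikeMatrix c w₀ δ i u v * spikeWeight w₀ δ v.1) = δ * c (i :: u.1) := by
          simp only [spikeMatrix, spikeWeight, Matrix.of_apply, hu, hv', hw₀, hum, and_self,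
            if_true, if_false]
          field_simp
          ring
        rw [this, abs_mul, abs_of_pos h0]
      · have : spikeMatrix c w₀ δ i u v = 0 := by simp [spikeMatrix, hu, hv']
        rw [this]
        simp only [zero_mul, mul_zero, abs_zero]
        positivity
    · have : spikeMatrix c w₀ δ i u v = 0 := by simp [spikeMatrix, hum]
      rw [this]
      simp only [zero_mul, mul_zero, abs_zero]
      positivity

/-- In the limit `δ → 0` only the words of length `m + 1` survive, all in the direction `w₀`. -/
lemma tendsto_evalAt_word_spike (c : List (Fin g) → ℝ) (hc : ∀ l, l.length ≤ m → c l = 0)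
    {w₀ : List (Fin g)} (hw₀ : w₀.length = m) (l : List (Fin g)) (hl : l.length ≤ m + 1)
    (u : Words g m) :
    Tendsto (fun δ : ℝ => δ * evalAt (fockOp (spikeWeight w₀ δ) (spikeMatrix c w₀ δ)) (word l)
      (vacuum m (spikeWeight w₀ δ)) u) (𝓝[>] 0) (𝓝 (if u.1 = w₀ then c l else 0)) := by
  have hsmall : ∀ᶠ δ : ℝ in 𝓝[>] 0, 0 < δ ∧ δ ≤ 1 := by
    filter_upwards [Ioc_mem_nhdsGT (zero_lt_one (α := ℝ))] with δ hδ using hδ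
  suffices H : ∃ D : ℝ, ∀ᶠ δ : ℝ in 𝓝[>] 0,
      |δ * evalAt (fockOp (spikeWeight w₀ δ) (spikeMatrix c w₀ δ)) (word l)
        (vacuum m (spikeWeight w₀ δ)) u - if u.1 = w₀ then c l else 0| ≤ δ * D by
    obtain ⟨D, hD⟩ := H
    rw [tendsto_iff_norm_sub_tendsto_zero]
    refine squeeze_zero' (Eventually.of_forall fun _ => norm_nonneg _) hD ?_
    have : Tendsto (fun δ : ℝ => δ * D) (𝓝 0) (𝓝 (0 * D)) := tendsto_id.mul_const D
    rw [zero_mul] at this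
    exact this.mono_left nhdsWithin_le_nhds
  rcases Nat.lt_or_ge m l.length with hlm | hlm
  · cases l with
    | nil => simp at hlm
    | cons i l =>
      have hl' : l.length = m := by simp at hl hlm; omega
      refine ⟨2 * 2 ^ m + |c (i :: u.1)|, ?_⟩
      filter_upwards [hsmall] with δ hδ
      have hρ := abs_spikeWeight_le (w₀ := w₀) hδ.1 hδ.2
      have hA := spikeMatrix_eq_zero (m := m) c w₀ δ
      rw [evalAt_word_cons_apply]
      set y := evalAt (fockOp (spikeWeight w₀ δ) (spikeMatrix c w₀ δ)) (word l)
        (vacuum m (spikeWeight w₀ δ))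
      have h1 := abs_fockOp_apply_sub_le (A := spikeMatrix c w₀ δ) hρ i (y := y)
        (C := 2 ^ m) (by positivity)
        (fun v => (abs_evalAt_word_vacuum_le hρ hA l hl'.le v).trans (by rw [hl'])) u
      have h2 : ∑ v, spikeMatrix c w₀ δ i u v * y v =
          spikeMatrix c w₀ δ i u ⟨l, hl'.le⟩ * spikeWeight w₀ δ l := by
        rw [Finset.sum_eq_single ⟨l, hl'.le⟩]
        · rw [evalAt_word_vacuum_apply hA l hl'.le _ le_rfl, if_pos rfl,
            suffixWeight_spikeWeight (by rw [hl', hw₀])]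
        · intro v _ hv
          rcases Nat.lt_or_ge v.1.length m with hvm | hvm
          · rw [hA i u v hvm, zero_mul]
          · rw [evalAt_word_vacuum_apply hA l hl'.le v (by omega),
              if_neg (fun h => hv (Subtype.ext h)), mul_zero]
        · simp
      have h3 := abs_spikeMatrix_mul_sub_le c hw₀ hδ.1 i u ⟨l, hl'.le⟩ hl'
      rw [h2] at h1
      calc _ = |δ * (fockOp (spikeWeight w₀ δ) (spikeMatrix c w₀ δ) i y u -
              spikeMatrix c w₀ δ i u ⟨l, hl'.le⟩ * spikeWeight w₀ δ l) +
            (δ * (spikeMatrix c w₀ δ i u ⟨l, hl'.le⟩ * spikeWeight w₀ δ l) -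
              if u.1 = w₀ then c (i :: l) else 0)| := by ring_nf
        _ ≤ δ * (2 * 2 ^ m) + δ * |c (i :: u.1)| := by
            refine (abs_add_le _ _).trans (add_le_add ?_ h3)
            rw [abs_mul, abs_of_pos hδ.1]
            exact mul_le_mul_of_nonneg_left h1 hδ.1.le
        _ = _ := by ring
  · refine ⟨2 ^ l.length, ?_⟩
    filter_upwards [hsmall] with δ hδ
    rw [hc l hlm, ite_self, sub_zero, abs_mul, abs_of_pos hδ.1]
    exact mul_le_mul_of_nonneg_left (abs_evalAt_word_vacuum_le (abs_spikeWeight_le hδ.1 hδ.2)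
      (spikeMatrix_eq_zero c w₀ δ) l hlm u) hδ.1.le

/-- If the Gram matrix of the top-degree part of a polynomial of degree at most `2 * m + 2` is
not positive, then the polynomial takes a negative value on the space of words of length at
most `m`. -/
lemma exists_inner_evalAt_neg
    (G : Matrix (List.Vector (Fin g) (m + 1)) (List.Vector (Fin g) (m + 1)) ℝ)
    (c : List.Vector (Fin g) (m + 1) → ℝ) (hG : ∑ u, ∑ v, G u v * (c u * c v) < 0)
    {r : NCPoly g} (hr : r ∈ degLE g (2 * m + 1)) :
    ∃ (X : Fin g → (EuclideanSpace ℝ (Words g m) →L[ℝ] EuclideanSpace ℝ (Words g m)))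
      (ζ : EuclideanSpace ℝ (Words g m)), IsSymmTuple X ∧
      inner ℝ (evalAt X (∑ u, ∑ v, G u v • (star (word u.toList) * word v.toList) + r) ζ) ζ < 0 := by
  obtain ⟨w, -⟩ : ∃ w : List.Vector (Fin g) (m + 1), w ∈ Finset.univ :=
    Finset.nonempty_of_sum_ne_zero hG.ne
  let w₀ : List (Fin g) := w.tail.toList
  have hw₀ : w₀.length = m := by simp [w₀]
  let c' : List (Fin g) → ℝ := fun l => if h : l.length = m + 1 then c ⟨l, h⟩ else 0
  have hc' : ∀ l, l.length ≤ m → c' l = 0 := fun l hl => dif_neg (by omega)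
  have hc'' : ∀ v : List.Vector (Fin g) (m + 1), c' v.toList = c v := fun v => dif_pos v.2
  let X : ℝ → Fin g → (EuclideanSpace ℝ (Words g m) →L[ℝ] EuclideanSpace ℝ (Words g m)) :=
    fun δ => fockOp (spikeWeight w₀ δ) (spikeMatrix c' w₀ δ)
  let ζ : ℝ → EuclideanSpace ℝ (Words g m) := fun δ => vacuum m (spikeWeight w₀ δ)
  have hX : ∀ δ, IsSymmTuple (X δ) := fun δ => isSymmTuple_fockOp (spikeMatrix_isSymm c' w₀ δ)
  have hpair : ∀ l l' : List (Fin g), l.length ≤ m + 1 → l'.length ≤ m + 1 →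
      Tendsto (fun δ => δ ^ 2 * inner ℝ (evalAt (X δ) (star (word l) * word l') (ζ δ)) (ζ δ))
        (𝓝[>] 0) (𝓝 (c' l * c' l')) := by
    intro l l' hl hl'
    have h1 : Tendsto (fun δ => ∑ u : Words g m, (δ * evalAt (X δ) (word l) (ζ δ) u) *
        (δ * evalAt (X δ) (word l') (ζ δ) u)) (𝓝[>] 0)
        (𝓝 (∑ u : Words g m, (if u.1 = w₀ then c' l else 0) * (if u.1 = w₀ then c' l' else 0))) :=
      tendsto_finsetSum _ fun u _ => (tendsto_evalAt_word_spike c' hc' hw₀ l hl u).mul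
        (tendsto_evalAt_word_spike c' hc' hw₀ l' hl' u)
    have h2 : ∑ u : Words g m, (if u.1 = w₀ then c' l else 0) * (if u.1 = w₀ then c' l' else 0) =
        c' l * c' l' := by
      rw [Finset.sum_eq_single ⟨w₀, hw₀.le⟩]
      · simp
      · intro u _ hu
        rw [if_neg (fun h => hu (Subtype.ext h)), zero_mul]
      · simp
    rw [h2] at h1
    refine h1.congr fun δ => ?_
    rw [inner_evalAt_star_mul (hX δ), PiLp.inner_apply, Finset.mul_sum]
    refine Finset.sum_congr rfl fun u _ => ?_
    simp
    ring
  have hr0 : Tendsto (fun δ => δ ^ 2 * inner ℝ (evalAt (X δ) r (ζ δ)) (ζ δ)) (𝓝[>] 0) (𝓝 0) := by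
    refine Submodule.span_induction ?_ ?_ ?_ ?_ hr
    · rintro _ ⟨l, hl, rfl⟩
      obtain ⟨u, v, hu, hv, huv⟩ := exists_word_eq_star_mul (j := m) (k := m + 1)
        (show l.length ≤ _ by omega)
      rw [huv]
      simpa [hc' u hu] using hpair u v (by omega) hv
    · simp
    · intro x y _ _ hx hy
      simpa [inner_add_left, mul_add] using hx.add hy
    · intro t x _ hx
      simpa [inner_smul_left, mul_left_comm] using hx.const_mul t
  have htop : Tendsto (fun δ => δ ^ 2 * inner ℝ (evalAt (X δ)
      (∑ u, ∑ v, G u v • (star (word u.toList) * word v.toList) + r) (ζ δ)) (ζ δ)) (𝓝[>] 0)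
      (𝓝 (∑ u, ∑ v, G u v * (c u * c v) + 0)) := by
    have h1 : Tendsto (fun δ => ∑ u, ∑ v, G u v * (δ ^ 2 * inner ℝ (evalAt (X δ)
        (star (word u.toList) * word v.toList) (ζ δ)) (ζ δ))) (𝓝[>] 0)
        (𝓝 (∑ u, ∑ v, G u v * (c u * c v))) := by
      refine tendsto_finsetSum _ fun u _ => tendsto_finsetSum _ fun v _ => ?_
      have := hpair u.toList v.toList (by simp) (by simp)
      rw [hc'', hc''] at this
      exact this.const_mul _
    refine (h1.add hr0).congr fun δ => ?_
    rw [map_add, add_apply, inner_add_left, mul_add]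
    congr 1
    simp only [map_sum, map_smul, sum_apply, smul_apply, sum_inner, inner_smul_left,
      Finset.mul_sum, RCLike.conj_to_real]
    refine Finset.sum_congr rfl fun u _ => Finset.sum_congr rfl fun v _ => ?_
    ring
  rw [add_zero] at htop
  obtain ⟨δ, hδ, hδ0⟩ := ((htop.eventually_lt_const hG).and self_mem_nhdsWithin).exists
  exact ⟨X δ, ζ δ, hX δ, by
    by_contra! h
    exact absurd hδ (not_lt.2 (mul_nonneg (sq_nonneg δ) h))⟩

end ConcentratedFock

section Positivstellensatz

universe w

variable {g : ℕ}

lemma sq_mem_degLE {k : ℕ} {u v : NCPoly g} (hu : u ∈ degLE g k) (hv : v ∈ degLE g k) :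
    star u * v ∈ degLE g (2 * k) := by
  rw [two_mul]
  exact mul_mem_degLE (star_mem_degLE hu) hv

lemma one_sub_star_mul_mem_degLE {a : ℕ} {s : NCPoly g} (hs : s ∈ degLE g a) :
    1 - star s * s ∈ degLE g (2 * a) :=
  sub_mem (one_mem_degLE _) (sq_mem_degLE hs hs)

/-- There are tuples of arbitrarily small norm with a vector that separates the polynomials of
degree at most `N`. -/
lemma exists_small_tuple_separating (g N : ℕ) {ε : ℝ} (hε : 0 < ε) :
    ∃ (X : Fin g → (EuclideanSpace ℝ (Words g N) →L[ℝ] EuclideanSpace ℝ (Words g N)))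
      (ζ : EuclideanSpace ℝ (Words g N)), IsSymmTuple X ∧ Real.sqrt (∑ i, ‖X i‖ ^ 2) < ε ∧
      ∀ f ∈ degLE g N, evalAt X f ζ = 0 → f = 0 := by
  let X₁ : Fin g → _ := fockOp (g := g) (m := N) (fun _ => 1) 0
  let R := Real.sqrt (∑ i, ‖X₁ i‖ ^ 2)
  have hR : 0 ≤ R := Real.sqrt_nonneg _
  let t := ε / (R + 1)
  have ht : 0 < t := by positivity
  have hXt : ∀ i, fockOp (g := g) (m := N) (fun _ => t) 0 i = t • X₁ i := by
    intro i
    ext y u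
    simp [X₁, fockOp_apply, Finset.mul_sum, mul_add]
  refine ⟨fockOp (fun _ => t) 0, vacuum N fun _ => t, isSymmTuple_fockOp fun i => ?_, ?_,
    fun f hf h0 => eq_zero_of_evalAt_vacuum_eq_zero (fun _ => ht.ne') (fun _ _ _ _ => rfl) hf h0⟩
  · exact Matrix.transpose_zero
  · have h1 : ∑ i, ‖fockOp (g := g) (m := N) (fun _ => t) 0 i‖ ^ 2 = t ^ 2 * ∑ i, ‖X₁ i‖ ^ 2 := by
      rw [Finset.mul_sum]
      refine Finset.sum_congr rfl fun i _ => ?_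
      rw [hXt, norm_smul, Real.norm_eq_abs, abs_of_pos ht, mul_pow]
    rw [h1, Real.sqrt_mul (sq_nonneg t), Real.sqrt_sq ht.le]
    change ε / (R + 1) * R < ε
    rw [div_mul_eq_mul_div, div_lt_iff₀ (by positivity)]
    nlinarith

/-- A functional that is positive definite on polynomials up to a given degree, also with the
weights `1 - s* s`. -/
lemma exists_positive_definite_functional {S : Finset (NCPoly g)}
    (hS_symm : ∀ s ∈ S, star s = s) (hnhd : ContainsNCNhd (complSquares S)) (N : ℕ) :
    ∃ L : NCPoly g →ₗ[ℝ] ℝ, (∀ f ∈ degLE g N, f ≠ 0 → 0 < L (star f * f)) ∧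
      ∀ s ∈ S, ∀ f, (1 - star s * s) * f ∈ degLE g N → (1 - star s * s) * f ≠ 0 →
        0 < L (star f * (1 - star s * s) * f) := by
  obtain ⟨ε, hε, hcontr⟩ := hnhd.exists_contraction
  obtain ⟨X, ζ, hX, hsmall, hsep⟩ := exists_small_tuple_separating g N hε
  have hs := hcontr _ X hX hsmall
  refine ⟨(innerₗ _ ζ) ∘ₗ (ContinuousLinearMap.apply ℝ _ ζ).toLinearMap ∘ₗ
    (evalAt X).toLinearMap, fun f hf hf0 => ?_, fun s hsS f hf hf0 => ?_⟩
  · have h1 : evalAt X f ζ ≠ 0 := fun h => hf0 (hsep f hf h)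
    have h2 := inner_evalAt_star_mul hX f f ζ
    rw [real_inner_comm] at h2
    simp only [LinearMap.comp_apply, AlgHom.toLinearMap_apply, ContinuousLinearMap.coe_coe,
      ContinuousLinearMap.apply_apply, innerₗ_apply_apply, h2]
    exact real_inner_self_pos.2 h1
  · have h2 := inner_evalAt_star_mul hX f ((1 - star s * s) * f) ζ
    rw [real_inner_comm, ← mul_assoc] at h2
    simp only [LinearMap.comp_apply, AlgHom.toLinearMap_apply, ContinuousLinearMap.coe_coe,
      ContinuousLinearMap.apply_apply, innerₗ_apply_apply, h2]
    set y := evalAt X f ζ with hy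
    have hq : evalAt X ((1 - star s * s) * f) ζ = y - evalAt X s (evalAt X s y) := by
      simp [hS_symm s hsS, sub_mul, hy]
    have h0 : y - evalAt X s (evalAt X s y) ≠ 0 := hq ▸ fun h => hf0 (hsep _ hf h)
    have h3 : inner ℝ (evalAt X s (evalAt X s y)) y = ‖evalAt X s y‖ ^ 2 := by
      rw [inner_evalAt_left hX, hS_symm s hsS, real_inner_self_eq_norm_sq]
    have h4 := norm_sub_sq_real y (evalAt X s (evalAt X s y))
    rw [real_inner_comm, h3] at h4
    have h5 := hs s hsS y
    have h6 := hs s hsS (evalAt X s y)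
    have h7 : 0 < ‖y - evalAt X s (evalAt X s y)‖ ^ 2 := by positivity
    rw [hq, inner_sub_left, h3, real_inner_self_eq_norm_sq]
    nlinarith [norm_nonneg (evalAt X s (evalAt X s y)), norm_nonneg (evalAt X s y)]

/-- Separation from the cone of weighted squares of bounded degree. -/
lemma exists_separating_functional {J : Type*} [Finite J] [Nonempty J] (k : J → ℕ)
    (Q : J → NCPoly g) {M : ℕ}
    (hQ : ∀ j, ∀ u ∈ degLE g (k j), ∀ v ∈ degLE g (k j), star u * Q j * v ∈ degLE g M)
    (L : NCPoly g →ₗ[ℝ] ℝ) (hL : ∀ j, ∀ f ∈ degLE g (k j), f ≠ 0 → 0 < L (star f * Q j * f))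
    {p : NCPoly g} (hpM : p ∈ degLE g M)
    (hp : p ∉ AddSubmonoid.closure {x | ∃ j, ∃ f ∈ degLE g (k j), x = star f * Q j * f}) :
    ∃ ℓ : NCPoly g →ₗ[ℝ] ℝ, (∀ j, ∀ f ∈ degLE g (k j), 0 ≤ ℓ (star f * Q j * f)) ∧ ℓ p < 0 := by
  let b : ∀ j, degLE g (k j) →ₗ[ℝ] degLE g (k j) →ₗ[ℝ] degLE g M := fun j =>
    LinearMap.mk₂ ℝ (fun u v => ⟨star (u : NCPoly g) * Q j * v, hQ j u u.2 v v.2⟩)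
      (fun u u' v => Subtype.ext (by simp [add_mul]))
      (fun r u v => Subtype.ext (by simp [star_smul_poly]))
      (fun u v v' => Subtype.ext (by simp [mul_add]))
      (fun r u v => Subtype.ext (by simp))
  obtain ⟨ℓ, hℓ, hℓp⟩ := exists_separating_of_bilinear (fun j => degLE g (k j)) b
    (L ∘ₗ (degLE g M).subtype) (fun j u hu => hL j u u.2 (by simpa using hu))
    (let ⟨j⟩ := ‹Nonempty J›;
      ⟨j, ⟨1, one_mem_degLE _⟩, fun h => one_ne_zero (congrArg Subtype.val h)⟩)
    (p := ⟨p, hpM⟩) (fun h => hp (by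
      have hle : AddSubmonoid.closure {x | ∃ j u, x = b j u u} ≤
          (AddSubmonoid.closure {x | ∃ j, ∃ f ∈ degLE g (k j), x = star f * Q j * f}).comap
            (degLE g M).subtype.toAddMonoidHom := by
        refine AddSubmonoid.closure_le.2 ?_
        rintro _ ⟨j, u, rfl⟩
        exact AddSubmonoid.subset_closure ⟨j, u, u.2, rfl⟩
      exact hle h))
  obtain ⟨ℓ', hℓ'⟩ := ℓ.exists_extend
  have hext : ∀ x : degLE g M, ℓ' x = ℓ x := fun x => LinearMap.congr_fun hℓ' x
  refine ⟨ℓ', fun j f hf => ?_, ?_⟩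
  · rw [← Subtype.coe_mk (star f * Q j * f) (hQ j f hf f hf), hext]
    exact hℓ j ⟨f, hf⟩
  · rw [← Subtype.coe_mk p hpM, hext]
    exact hℓp

/-- A symmetric polynomial outside the truncated quadratic module is separated from it by
a symmetric functional that is positive definite on squares. -/
lemma exists_symmetric_separating_functional {a d β : ℕ} (hβ : β < d) {S : Finset (NCPoly g)}
    (hS_symm : ∀ s ∈ S, star s = s) (hS_deg : ∀ s ∈ S, s ∈ degLE g a)
    (hnhd : ContainsNCNhd (complSquares S)) {p : NCPoly g} (hp_symm : star p = p)
    (hp_deg : p ∈ degLE g (2 * d)) (hp : p ∉ quadModule (d + a) β (complSquares S)) :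
    ∃ L : NCPoly g →ₗ[ℝ] ℝ, (∀ f, L (star f) = L f) ∧
      (∀ f ∈ degLE g (d + a), f ≠ 0 → 0 < L (star f * f)) ∧
      (∀ s ∈ S, ∀ f ∈ degLE g β, L (star (s * f) * (s * f)) ≤ L (star f * f)) ∧ L p < 0 := by
  obtain ⟨L₀, hL₀, hL₀'⟩ := exists_positive_definite_functional hS_symm hnhd (2 * (d + a))
  let J := Option {s // s ∈ S ∧ 1 - star s * s ≠ 0}
  have : Finite {s // s ∈ S ∧ 1 - star s * s ≠ 0} :=
    Set.Finite.subset S.finite_toSet fun s hs => hs.1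
  let k : J → ℕ := fun j => j.elim (d + a) fun _ => β
  let Q : J → NCPoly g := fun j => j.elim 1 fun s => 1 - star s.1 * s.1
  have hdeg : ∀ s ∈ S, ∀ f ∈ degLE g β, (1 - star s * s) * f ∈ degLE g (2 * (d + a)) :=
    fun s hs f hf => degLE_mono (by omega)
      (mul_mem_degLE (one_sub_star_mul_mem_degLE (hS_deg s hs)) hf)
  obtain ⟨ℓ, hℓ, hℓp⟩ := exists_separating_functional k Q (M := 2 * (d + a))
    (by
      rintro (_ | ⟨s, hs, hs0⟩) u hu v hv
      · simpa [Q, k] using sq_mem_degLE hu hv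
      · exact degLE_mono (show β + 2 * a + β ≤ _ by omega) (mul_mem_degLE (mul_mem_degLE
          (star_mem_degLE hu) (one_sub_star_mul_mem_degLE (hS_deg s hs))) hv))
    L₀
    (by
      rintro (_ | ⟨s, hs, hs0⟩) f hf hf0
      · simpa [Q] using hL₀ f (degLE_mono (show d + a ≤ _ by omega) hf) hf0
      · exact hL₀' s hs f (hdeg s hs f hf) (mul_ne_zero hs0 hf0))
    (degLE_mono (by omega) hp_deg)
    (by
      intro h
      apply hp
      have hle : AddSubmonoid.closure {x | ∃ j, ∃ f ∈ degLE g (k j), x = star f * Q j * f} ≤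
          sos g (d + a) ⊔ weightedSos β (complSquares S) := by
        refine AddSubmonoid.closure_le.2 ?_
        rintro _ ⟨_ | ⟨s, hs, hs0⟩, f, hf, rfl⟩
        · exact AddSubmonoid.mem_sup_left (AddSubmonoid.subset_closure ⟨f, hf, by simp [Q]⟩)
        · exact AddSubmonoid.mem_sup_right
            (AddSubmonoid.subset_closure ⟨_, ⟨s, hs, rfl⟩, f, hf, rfl⟩)
      obtain ⟨x, hx, y, hy, hxy⟩ := AddSubmonoid.mem_sup.1 (hle h)
      exact ⟨x, hx, y, hy, hxy.symm⟩)
  have hℓsq : ∀ f ∈ degLE g (d + a), 0 ≤ ℓ (star f * f) := fun f hf => by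
    simpa [Q] using hℓ none f hf
  have hexp : ∀ s f : NCPoly g,
      star f * (1 - star s * s) * f = star f * f - star (s * f) * (s * f) := fun s f => by
    rw [star_mul]
    noncomm_ring
  have hweight : ∀ F : NCPoly g →ₗ[ℝ] ℝ, (∀ s ∈ S, ∀ f ∈ degLE g β, 1 - star s * s ≠ 0 →
      0 ≤ F (star f * (1 - star s * s) * f)) → ∀ s ∈ S, ∀ f ∈ degLE g β,
      F (star (s * f) * (s * f)) ≤ F (star f * f) := by
    intro F hF s hs f hf
    rw [← sub_nonneg, ← map_sub, ← hexp]
    by_cases h : 1 - star s * s = 0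
    · simp [h]
    · exact hF s hs f hf h
  have hℓw := hweight ℓ fun s hs f hf h => hℓ (some ⟨s, hs, h⟩) f hf
  have hL₀w := hweight L₀ fun s hs f hf h => by
    by_cases hf0 : f = 0
    · simp [hf0]
    · exact (hL₀' s hs f (hdeg s hs f hf) (mul_ne_zero h hf0)).le
  let τ := -ℓ p / (2 * (|L₀ p| + 1))
  have hτ : 0 < τ := div_pos (by linarith) (by positivity)
  have hτp : τ * L₀ p < -ℓ p := by
    calc τ * L₀ p ≤ τ * |L₀ p| := by gcongr; exact le_abs_self _
      _ < τ * (2 * (|L₀ p| + 1)) := by gcongr; linarith [abs_nonneg (L₀ p)]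
      _ = -ℓ p := div_mul_cancel₀ _ (by positivity)
  let L₁ := ℓ + τ • L₀
  let L := (2⁻¹ : ℝ) • (L₁ + L₁ ∘ₗ starLinear g)
  have hLherm : ∀ f, star f = f → L f = ℓ f + τ * L₀ f := fun f hf => by
    simp only [L, L₁, LinearMap.smul_apply, LinearMap.add_apply, LinearMap.comp_apply,
      starLinear_apply, hf, smul_eq_mul]
    ring
  have hsq : ∀ f : NCPoly g, L (star f * f) = ℓ (star f * f) + τ * L₀ (star f * f) :=
    fun f => hLherm _ (by simp)
  refine ⟨L, fun f => ?_, fun f hf hf0 => ?_, fun s hs f hf => ?_, ?_⟩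
  · simp only [L, LinearMap.smul_apply, LinearMap.add_apply, LinearMap.comp_apply,
      starLinear_apply, star_star, add_comm]
  · rw [hsq]
    exact add_pos_of_nonneg_of_pos (hℓsq f hf)
      (mul_pos hτ (hL₀ f (degLE_mono (by omega) hf) hf0))
  · rw [hsq, hsq]
    exact add_le_add (hℓw s hs f hf) (mul_le_mul_of_nonneg_left (hL₀w s hs f hf) hτ.le)
  · rw [hLherm p hp_symm]
    linarith

lemma abs_le_one_of_containsNCNhd {S : Finset (NCPoly g)}
    (hnhd : ContainsNCNhd (complSquares S)) {c : ℝ} (hc : c • (1 : NCPoly g) ∈ S) : |c| ≤ 1 := by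
  obtain ⟨ε, hε, h⟩ := hnhd.exists_contraction
  simpa [norm_smul] using h ℝ 0 (fun i => LinearMap.IsSymmetric.zero) (by simpa) _ hc 1

/-- Either the top-degree part of a symmetric polynomial is a sum of squares, or the polynomial
takes a negative value on a space whose dimension is that of the polynomials of degree at
most `m`. -/
lemma exists_sum_squares_or_neg {m : ℕ} {p : NCPoly g} (hp_symm : star p = p)
    (hp_deg : p ∈ degLE g (2 * (m + 1))) :
    (∃ (n : ℕ) (h : Fin n → NCPoly g), (∀ i, h i ∈ degLE g (m + 1)) ∧
      ∃ r ∈ degLE g (2 * m + 1), p = ∑ i, star (h i) * h i + r) ∨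
    ∃ (X : Fin g → (EuclideanSpace ℝ (ULift.{w} (Fin (sigmaDim g m))) →L[ℝ]
        EuclideanSpace ℝ (ULift.{w} (Fin (sigmaDim g m)))))
      (ζ : EuclideanSpace ℝ (ULift.{w} (Fin (sigmaDim g m)))), IsSymmTuple X ∧
      inner ℝ (evalAt X p ζ) ζ < 0 := by
  obtain ⟨G, hG, r, hr, rfl⟩ := exists_isSymm_gram_of_mem_degLE hp_deg hp_symm
  by_cases hpsd : G.PosSemidef
  · left
    obtain ⟨n, v, rfl⟩ := Matrix.posSemidef_iff_eq_sum_vecMulVec.1 hpsd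
    refine ⟨n, fun i => ∑ u, v i u • word u.toList, fun i => sum_mem fun u _ =>
      Submodule.smul_mem _ _ (word_mem_degLE (by simp)), r, hr, ?_⟩
    congr 1
    simp only [Matrix.sum_apply, Matrix.vecMulVec_apply, Finset.sum_smul, star_sum,
      Finset.sum_mul_sum, star_smul_poly, smul_mul_smul_comm, star_trivial]
    refine Eq.trans (Finset.sum_congr rfl fun u _ => ?_) Finset.sum_comm
    exact Finset.sum_comm
  · right
    obtain ⟨c, hc⟩ : ∃ c : List.Vector (Fin g) (m + 1) → ℝ,
        ∑ u, ∑ v, G u v * (c u * c v) < 0 := by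
      by_contra! h
      refine hpsd (Matrix.PosSemidef.of_dotProduct_mulVec_nonneg
        (G.conjTranspose_eq_transpose_of_trivial.trans hG) fun c => ?_)
      refine (h c).trans_eq ?_
      simp only [dotProduct, Matrix.mulVec, Finset.mul_sum, Pi.star_apply, star_trivial]
      refine Finset.sum_congr rfl fun u _ => Finset.sum_congr rfl fun v _ => ?_
      ring
    obtain ⟨X, ζ, hX, hneg⟩ := exists_inner_evalAt_neg G c hc hr
    have hdim : Module.finrank ℝ (EuclideanSpace ℝ (Words g m)) = sigmaDim g m := by
      rw [finrank_euclideanSpace, sigmaDim_eq_card, Nat.card_eq_fintype_card]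
    let Ψ := ((stdOrthonormalBasis ℝ (EuclideanSpace ℝ (Words g m))).reindex
      ((finCongr hdim).trans Equiv.ulift.{w}.symm)).repr
    refine ⟨conjTuple Ψ X, Ψ ζ, hX.conjTuple Ψ, ?_⟩
    rwa [evalAt_conjTuple_apply, Ψ.inner_map_map]

end Positivstellensatz

end FreePos

end

theorem theorem4p5 (g a d β : ℕ) (hβ : β < d)
    (S : Finset (FreePos.NCPoly g))
    (hS_symm : ∀ s ∈ S, star s = s)
    (hS_deg : ∀ s ∈ S, s ∈ FreePos.degLE g a)
    (hnhd : FreePos.ContainsNCNhd (FreePos.complSquares S))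
    (p : FreePos.NCPoly g) (hp_symm : star p = p) (hp_deg : p ∈ FreePos.degLE g (2 * d)) :
    (∀ (E : Type*) [NormedAddCommGroup E] [InnerProductSpace ℝ E] [FiniteDimensional ℝ E],
        Module.finrank ℝ E = FreePos.sigmaDim g (d + a - 1) →
        ∀ (X : Fin g → (E →L[ℝ] E)) (ζ : E), FreePos.IsSymmTuple X →
          (∀ s ∈ S,
            (FreePos.orbitProj X ζ β *
              (1 - FreePos.evalAt X (star s) * FreePos.evalAt X s) *
              FreePos.orbitProj X ζ β).IsPositive) →
          0 ≤ inner ℝ (FreePos.evalAt X p ζ) ζ) ↔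
      p ∈ FreePos.quadModule (d + a) β (FreePos.complSquares S) := by
  open FreePos in
  refine ⟨fun H => ?_, fun hp E _ _ _ _ X ζ hX hpos => inner_evalAt_nonneg_of_mem_quadModule hp hX
    fun s hs => (isPositive_compression_iff hX ζ β s).1 (hpos s hs)⟩
  by_contra hp
  obtain ⟨L, hL_symm, hL_pos, hL_S, hLp⟩ := exists_symmetric_separating_functional hβ hS_symm
    hS_deg hnhd hp_symm hp_deg hp
  obtain ⟨m, hm⟩ : ∃ m, d + a = m + 1 := ⟨d + a - 1, by omega⟩
  rw [hm] at H hL_pos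
  obtain ⟨X, ζ, hX, hXL, hXsq⟩ := exists_gns L hL_symm hL_pos
  have hge := H _ (by simp) X ζ hX fun s hs => by
    rw [isPositive_compression_iff hX]
    intro f hf
    have hsf : s * f ∈ degLE g m := degLE_mono (by omega) (mul_mem_degLE (hS_deg s hs) hf)
    have hnorm : ∀ h ∈ degLE g m, ‖evalAt X h ζ‖ ^ 2 = L (star h * h) := fun h hh => by
      rw [← hXL _ (degLE_mono (by omega) (sq_mem_degLE hh hh)), inner_evalAt_star_mul hX,
        real_inner_self_eq_norm_sq]
    refine le_of_sq_le_sq ?_ (norm_nonneg _)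
    rw [hnorm _ hsf, hnorm f (degLE_mono (by omega) hf)]
    exact hL_S s hs f hf
  rcases Nat.eq_zero_or_pos a with rfl | ha
  · rw [add_zero] at hm
    subst hm
    rcases exists_sum_squares_or_neg hp_symm hp_deg with ⟨n, h, hh, r, hr, rfl⟩ |
      ⟨Y, η, hY, hneg⟩
    · refine hLp.not_ge (hge.trans ?_)
      rw [map_add, map_add, add_apply, inner_add_left, hXL r hr]
      gcongr
      simp only [map_sum, sum_apply, sum_inner]
      refine Finset.sum_le_sum fun i _ => ?_
      rw [inner_evalAt_star_mul hX, real_inner_self_eq_norm_sq]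
      exact hXsq _ (hh i)
    · refine hneg.not_ge (H _ (by simp) Y η hY fun s hs => ?_)
      rw [isPositive_compression_iff hY]
      intro f _
      obtain ⟨c, rfl⟩ := mem_degLE_zero.1 (hS_deg s hs)
      rw [smul_mul_assoc, one_mul, map_smul, smul_apply, norm_smul]
      exact mul_le_of_le_one_left (norm_nonneg _) (abs_le_one_of_containsNCNhd hnhd hs)
  · rw [hXL p (degLE_mono (by omega) hp_deg)] at hge
    exact hLp.not_ge hge
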